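/- **Setting.** Let $\mathcal X$ be a separable metrizable topological space with its Borel $\sigma$-algebra $\mathcal B$, and let $\mathcal A$ be a finite discrete action space with $|\mathcal A|\ge 2$. Let $\mathbb X=(X_t)_{t\ge1}$ be a stochastic process on $\mathcal X$. Rewards take values in $[0,1]$. *Learning rules.* A (possibly randomized) learning rule is a sequence of measurable functions $f_t$; at time $t$ it selects $\hat a_t=f_t(S,(X_s)_{s<t},(r_s)_{s<t},X_t)\in\mathcal A$, where $r_s$ is the reward received at time $s$ for the selected action $\hat a_s$ and $S$ is a random seed independent of $\mathbb X$. *Prescient rewards.* A prescient reward mechanism is a sequence of probability kernels $P_t(\cdot\mid a,\mathbf x)$ on $[0,1]$, $a\in\mathcal A$, $\mathbf x\in\mathcal X^{\infty}$; given the complete sequence $\mathbb X$, the seed and all earlier rewards (hence also given the selected actions), the reward $r_t(a)$ of action $a$ at time $t$ has distribution $P_t(\cdot\mid a,\mathbb X)$. A learning rule is consistent under $\mathbb X$ with these rewards if for every measurable $\pi:\mathcal X\to\mathcal A$, $$\limsup_{T\to\infty}\frac1T\sum_{t=1}^T \bigl(r_t(\pi(X_t))-r_t(\hat a_t)\bigr)\le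 0\quad\text{almost surely.}$$ $\mathcal C_{prescient}$ is the class of processes $\mathbb X$ for which some learning rule is consistent under $\mathbb X$ with every prescient reward mechanism. *Conditions.* For $i\ge0$ and $k=u2^i+v$ with $u\ge0$, $0\le v<2^i$, put $T_i^k=\lfloor 2^u(1+v2^{-i})\rfloor$, and let $\mathcal T^i$ be the random set of times $t\ge1$ such that, for the $k$ with $T_i^k\le t<T_i^{k+1}$, $X_{t'}\ne X_t$ for all $T_i^k\le t'<t$. For $A\in\mathcal B$ put $$\hat\mu_{\mathbb X^i}(A)=\limsup_{T\to\infty}\frac1T\sum_{t\le T,\,t\in\mathcal T^i}\mathbf 1_A(X_t).$$ $\mathbb X\in\mathcal C_4$ if $\lim_{i\to\infty}\mathbb E[\hat\mu_{\mathbb X^i}(A_i)]=0$ for every sequence $(A_i)$ of disjoint measurable sets. For $p\ge0$, $\epsilon>0$, $T\ge1$ let (with $\sup\emptyset=0$) $$\bar\delta^p(\epsilon;T)=\sup\Bigl\{0\le\delta\le1:\ \forall A\in\mathcal B\text{ with }\sup_{l}\mathbb E[\hat\mu_{\mathbb X^l}(A)]\le\delta,\ \ \mathbb E\Bigl[\sup_{T'\ge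 T}\frac1{T'}\sum_{t\le T',\,t\in\mathcal T^p}\mathbf 1_A(X_t)\Bigr]\le\epsilon\Bigr\},$$ and $\bar\delta^p(\epsilon)=\lim_{T\to\infty}\bar\delta^p(\epsilon;T)$. $\mathbb X\in\mathcal C_7$ if $\mathbb X\in\mathcal C_4$ and for every $\epsilon>0$ the limit $\lim_{p\to\infty}\bar\delta^p(\epsilon)$ exists and is positive. **Theorem.** $\mathcal C_{prescient}\subset\mathcal C_7$: every process on $\mathcal X$ that admits universal learning under prescient rewards with action space $\mathcal A$ satisfies $\mathcal C_7$. -/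

import Mathlib

open MeasureTheory ProbabilityTheory Filter Topology
open scoped ENNReal unitInterval

universe u v w z

namespace ContextualBandit

/-!
Time conventions.  A context sequence is `x : ℕ → 𝓧`, where `x n` is the context of round `n + 1`.
Rounds ("times") `t = 1, 2, …` are written `t = n + 1`.
-/

section Conditions

variable {𝓧 : Type u}

/-- The time scale `T_i^k = ⌊2^u (1 + v 2^{-i})⌋`, where `k = u 2^i + v`, `0 ≤ v < 2^i`. -/
noncomputable def timeScale (i k : ℕ) : ℕ :=
  ⌊(2 : ℝ) ^ (k / 2 ^ i) * (1 + ((k % 2 ^ i : ℕ) : ℝ) / 2 ^ i)⌋₊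

/-- The random set of times `𝒯^i`, for the context sequence `x`: the times `t ≥ 1` such that the
context of time `t` did not occur earlier in the period `[T_i^k, T_i^{k+1})` that contains `t`.
Indices `n`, `m` stand for the times `n + 1`, `m + 1`. -/
def firstTimes (i : ℕ) (x : ℕ → 𝓧) : Set ℕ :=
  {n | ∃ k, timeScale i k ≤ n + 1 ∧ n + 1 < timeScale i (k + 1) ∧
    ∀ m, timeScale i k ≤ m + 1 → m < n → x m ≠ x n}

open Classical in
/-- `(1 / T) ∑_{t ≤ T, t ∈ 𝒯^i} 1_A (X_t)`. -/
noncomputable def empFreq (i : ℕ) (A : Set 𝓧) (x : ℕ → 𝓧) (T : ℕ) : ℝ≥0∞ :=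
  (∑ n ∈ Finset.range T, if n ∈ firstTimes i x ∧ x n ∈ A then 1 else 0) / (T : ℝ≥0∞)

/-- The limit submeasure `μ̂_{𝕏^i}(A) = limsup_T (1 / T) ∑_{t ≤ T, t ∈ 𝒯^i} 1_A (X_t)` of the
extended process `𝕏^i = (X_t)_{t ∈ 𝒯^i}`. -/
noncomputable def limitSubmeasure (i : ℕ) (A : Set 𝓧) (x : ℕ → 𝓧) : ℝ≥0∞ :=
  limsup (fun T => empFreq i A x T) atTop

variable {Ω : Type v} [MeasurableSpace Ω] [MeasurableSpace 𝓧]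

/-- Condition `𝒞₄`: for all disjoint measurable sets `A_i`, `𝔼[μ̂_{𝕏^i}(A_i)] → 0`. -/
def C4 (μ : Measure Ω) (X : ℕ → Ω → 𝓧) : Prop :=
  ∀ A : ℕ → Set 𝓧, (∀ i, MeasurableSet (A i)) → Pairwise (fun i j => Disjoint (A i) (A j)) →
    Tendsto (fun i => ∫⁻ ω, limitSubmeasure i (A i) (fun n => X n ω) ∂μ) atTop (𝓝 0)

/-- `δ̄^p(ε; T)`: the supremum of the `δ ∈ [0, 1]` such that every measurable set `A` with
`sup_l 𝔼[μ̂_{𝕏^l}(A)] ≤ δ` satisfies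
`𝔼[sup_{T' ≥ T} (1 / T') ∑_{t ≤ T', t ∈ 𝒯^p} 1_A (X_t)] ≤ ε` (`sup ∅ = 0`). -/
noncomputable def deltaBarAt (μ : Measure Ω) (X : ℕ → Ω → 𝓧) (p : ℕ) (ε : ℝ) (T : ℕ) : ℝ≥0∞ :=
  sSup {δ : ℝ≥0∞ | δ ≤ 1 ∧ ∀ A : Set 𝓧, MeasurableSet A →
    (⨆ l : ℕ, ∫⁻ ω, limitSubmeasure l A (fun n => X n ω) ∂μ) ≤ δ →
    ∫⁻ ω, (⨆ T' : ℕ, ⨆ _ : T ≤ T', empFreq p A (fun n => X n ω) T') ∂μ ≤ ENNReal.ofReal ε}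

/-- `δ̄^p(ε) = lim_{T → ∞} δ̄^p(ε; T)`; the limit exists, see `tendsto_deltaBarAt`. -/
noncomputable def deltaBar (μ : Measure Ω) (X : ℕ → Ω → 𝓧) (p : ℕ) (ε : ℝ) : ℝ≥0∞ :=
  limUnder atTop (fun T => deltaBarAt μ X p ε T)

theorem deltaBarAt_mono (μ : Measure Ω) (X : ℕ → Ω → 𝓧) (p : ℕ) (ε : ℝ) :
    Monotone (deltaBarAt μ X p ε) := by
  intro S T hST
  refine sSup_le_sSup ?_
  rintro δ ⟨h1, h⟩
  refine ⟨h1, fun A hA hl => (lintegral_mono fun ω => ?_).trans (h A hA hl)⟩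
  exact iSup_mono fun T' => iSup_mono' fun h' => ⟨hST.trans h', le_rfl⟩

theorem deltaBar_eq_iSup (μ : Measure Ω) (X : ℕ → Ω → 𝓧) (p : ℕ) (ε : ℝ) :
    deltaBar μ X p ε = ⨆ T, deltaBarAt μ X p ε T :=
  (tendsto_atTop_iSup (deltaBarAt_mono μ X p ε)).limUnder_eq

theorem tendsto_deltaBarAt (μ : Measure Ω) (X : ℕ → Ω → 𝓧) (p : ℕ) (ε : ℝ) :
    Tendsto (deltaBarAt μ X p ε) atTop (𝓝 (deltaBar μ X p ε)) := by
  rw [deltaBar_eq_iSup]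
  exact tendsto_atTop_iSup (deltaBarAt_mono μ X p ε)

/-- Condition `𝒞₇`: `𝕏 ∈ 𝒞₄` and, for every `ε > 0`, `lim_{p → ∞} δ̄^p(ε)` exists and is
positive. -/
def C7 (μ : Measure Ω) (X : ℕ → Ω → 𝓧) : Prop :=
  C4 μ X ∧ ∀ ε : ℝ, 0 < ε →
    ∃ c : ℝ≥0∞, 0 < c ∧ Tendsto (fun p => deltaBar μ X p ε) atTop (𝓝 c)

end Conditions

section Learning

variable {𝓧 : Type u} {𝓐 : Type v} [MeasurableSpace 𝓧] [MeasurableSpace 𝓐]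

/-- A (possibly randomized) learning rule with rewards in `[0, 1]`.  The randomness is a seed, drawn
once from a probability space and shared by all rounds, so that a rule may remember the actions it
has selected.  At time `n + 1` the rule is a measurable function of the seed, the `n` past
contexts, the `n` received rewards and the current context. -/
structure LearningRule (𝓧 : Type u) (𝓐 : Type v) [MeasurableSpace 𝓧] [MeasurableSpace 𝓐] where
  Seed : Type w
  [measurableSpaceSeed : MeasurableSpace Seed]
  seedLaw : Measure Seed
  [isProbabilityMeasure_seedLaw : IsProbabilityMeasure seedLaw]
  act : (n : ℕ) → Seed × (Fin n → 𝓧) × (Fin n → I) × 𝓧 → 𝓐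
  measurable_act : ∀ n, Measurable (act n)

attribute [instance] LearningRule.measurableSpaceSeed LearningRule.isProbabilityMeasure_seedLaw

/-- The action `â_{n+1}` selected at time `n + 1`, for the seed `s`, the context sequence `x` and
the reward table `r`, where `r m a` is the reward of action `a` at time `m + 1`.  The rule receives
only the rewards `r m (â_{m+1})`, `m < n`, of the actions that it has selected. -/
def LearningRule.action (f : LearningRule.{u, v, w} 𝓧 𝓐) (s : f.Seed) (x : ℕ → 𝓧)
    (r : ℕ → 𝓐 → I) (n : ℕ) : 𝓐 :=
  f.act n (s, fun m => x m, fun m => r m (f.action s x r m), x n)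
termination_by n
decreasing_by exact m.isLt

theorem LearningRule.action_eq (f : LearningRule.{u, v, w} 𝓧 𝓐) (s : f.Seed) (x : ℕ → 𝓧)
    (r : ℕ → 𝓐 → I) (n : ℕ) :
    f.action s x r n = f.act n (s, fun m => x m, fun m => r m (f.action s x r m), x n) := by
  rw [LearningRule.action]

/-- A prescient reward mechanism: for each time `n + 1`, the conditional distribution of the reward
given the selected action and the complete context sequence. -/
structure PrescientRewards (𝓧 : Type u) (𝓐 : Type v) [MeasurableSpace 𝓧] [MeasurableSpace 𝓐] where
  condLaw : ℕ → Kernel (𝓐 × (ℕ → 𝓧)) I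
  isMarkovKernel_condLaw : ∀ n, IsMarkovKernel (condLaw n)

/-- `Q` is a joint law of the context sequence, the seed of the rule `f` and the reward table, when
the contexts have law `L` and the rewards follow the prescient mechanism `P`: the seed is
independent of the contexts, and, given the contexts, the seed and all earlier rewards (hence also
given the selected actions), the reward at time `n + 1` of action `a` has distribution
`P.condLaw n (a, x)`. -/
structure IsPrescientLaw (L : Measure (ℕ → 𝓧)) (f : LearningRule.{u, v, w} 𝓧 𝓐)
    (P : PrescientRewards 𝓧 𝓐) (Q : Measure ((ℕ → 𝓧) × f.Seed × (ℕ → 𝓐 → I))) : Prop where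
  hasLaw_context_seed : HasLaw (fun q => (q.1, q.2.1)) (L.prod f.seedLaw) Q
  hasCondDistrib_reward : ∀ (n : ℕ) (a : 𝓐),
    HasCondDistrib (fun q => q.2.2 n a)
      (fun q => ((q.1, q.2.1, fun m => q.2.2 m) : (ℕ → 𝓧) × f.Seed × (Fin n → 𝓐 → I)))
      ((P.condLaw n).comap (fun h => (a, h.1)) (by fun_prop)) Q

/-- `f` is consistent under contexts of law `L` with the prescient rewards `P`: against every
measurable policy `π`, almost surely
`limsup_T (1 / T) ∑_{t ≤ T} (r_t(π(X_t)) - r_t(â_t)) ≤ 0`. -/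
def LearningRule.IsConsistent (f : LearningRule.{u, v, w} 𝓧 𝓐) (L : Measure (ℕ → 𝓧))
    (P : PrescientRewards 𝓧 𝓐) : Prop :=
  ∀ Q : Measure ((ℕ → 𝓧) × f.Seed × (ℕ → 𝓐 → I)), IsPrescientLaw L f P Q →
    ∀ π : 𝓧 → 𝓐, Measurable π → ∀ᵐ q ∂Q,
      limsup (fun T : ℕ => (1 / (T : ℝ)) * ∑ n ∈ Finset.range T,
        ((q.2.2 n (π (q.1 n)) : ℝ) - (q.2.2 n (f.action q.2.1 q.1 q.2.2 n) : ℝ))) atTop ≤ 0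

/-- `X` admits universal learning with prescient rewards (and actions in `𝓐`), i.e.
`X ∈ 𝒞_prescient`: some learning rule is consistent under `X` with all prescient rewards. -/
def AdmitsPrescientLearning (𝓐 : Type v) [MeasurableSpace 𝓐] {Ω : Type z} [MeasurableSpace Ω]
    (μ : Measure Ω) (X : ℕ → Ω → 𝓧) : Prop :=
  ∃ f : LearningRule.{u, v, w} 𝓧 𝓐, ∀ P : PrescientRewards 𝓧 𝓐,
    f.IsConsistent (μ.map (fun ω n => X n ω)) P

end Learning

end ContextualBandit

/-!
The learner is beaten by a game in which rewards are functions of the complete context sequence, so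
that the only randomness left to the learner is its seed.  Consistency turns such rewards into a
statement about expectations: the expected largest average regret in time intervals moving to
infinity tends to zero (`tendsto_lintegral_maxRegret`).  Hence rewards cannot be patched together,
one finite time interval after the other, with expected regret bounded below in each interval
against one fixed policy (`no_extension_chain`).

One round of the game uses a scale `p` and a set `A` that has, with positive probability, large
frequency among the first times of scale `p`, at some late time `T`.  The rewards, being prescient,
know `T`.  They are offered only at the first times with context in `A` in the last boundedly many
periods before `T` (`RewardWindow`).  There, a safe action `a₁` pays `3 / 4`, and a risky action
`a₂` pays the colour `0` or `1` of a cell of `𝓧`; the cells separate the contexts of the window, and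
the colours are independent and fair.  Trying `a₂` at a context for the first time costs `1 / 4` on
average, and the knowledge so gained can be used at most once in each later period, because contexts
do not recur among the first times of one period.  The rewards may stop after any period, unknown to
the learner.  If the regret against the constant policy `a₁` is small in all these worlds, then,
inductively over the periods, the number of explorations is small in each period; but then the
learner cannot follow the policy that knows the colours, which earns `7 / 8` on average
(`exploration_dilemma`).  The bounds involve only the number of periods, so that either the regret
against `a₁` is at least a constant depending on `p`, or the regret against a policy fitted to `A`
is at least a constant independent of `p` (`exists_regret_extension`).

The first alternative cannot occur forever at one scale, since `a₁` is a fixed policy.  So the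
second one can be forced at every stage (`exists_fitted_regret_extension`).  If the sets `A` of the
different stages are disjoint, the fitted policies combine to one policy with large regret at
arbitrarily late times, a contradiction (`not_consistent_of_game`).  A violation of `𝒞₄` provides
disjoint sets directly.  The `δ̄^p(ε)` decrease in `p`, hence converge; if their limit is `0`, there
are sets `A` of arbitrarily small limit submeasure with large frequency at late times, and they
become disjoint by removing the earlier ones, whose frequency at late times is small.
-/

namespace ContextualBandit

/-! ### Exploration of hidden random cells -/

section Exploration

variable {K : Type*} [DecidableEq K]

/-- The colouring `c` with the colour of the cell `k` inverted. -/
def flipCell (k : K) (c : K → Bool) : K → Bool := Function.update c k (!c k)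

theorem flipCell_involutive (k : K) : Function.Involutive (flipCell k) := by
  intro c
  simp [flipCell]

theorem flipCell_self (k : K) (c : K → Bool) : flipCell k c k = !c k := by simp [flipCell]

theorem flipCell_of_ne {k l : K} (h : l ≠ k) (c : K → Bool) : flipCell k c l = c l := by
  simp [flipCell, h]

/-- The round `n` of the window `W` is the first one whose cell is explored, where `e m` says that
the round `m` is explored. -/
def IsFirstExploration (W : Finset ℕ) (cell : ℕ → K) (e : ℕ → Prop) (n : ℕ) : Prop :=
  e n ∧ ∀ m ∈ W, m < n → cell m = cell n → ¬ e m

theorem sum_flipCell [Fintype K] (k : K) (F : (K → Bool) → ℝ) :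
    ∑ c, F (flipCell k c) = ∑ c, F c :=
  Equiv.sum_comp (flipCell_involutive k).toPerm F

theorem sum_ite_colour [Fintype K] (k : K) (a : ℝ) :
    ∑ c : K → Bool, (if c k = true then a else 0) = Fintype.card (K → Bool) * (a / 2) := by
  have h := sum_flipCell k (fun c => if c k = true then a else 0)
  have h2 : ∑ c : K → Bool, ((if c k = true then a else 0) + (if flipCell k c k = true then a else 0))
      = Fintype.card (K → Bool) * a := by
    rw [Finset.sum_congr rfl (g := fun _ => a)]
    · simp
    · intro c _
      rw [flipCell_self]
      cases c k <;> simp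
  rw [Finset.sum_add_distrib, h] at h2
  linarith

variable {W : Finset ℕ} {st : ℕ → ℕ} {cell : ℕ → K} {e : (K → Bool) → ℕ → Prop}

/-- Whether a round is a first exploration does not depend on the colour of its cell. -/
theorem isFirstExploration_flipCell
    (hcausal : ∀ n ∈ W, ∀ c c' : K → Bool, (∀ m ∈ W, m < n → e c m → c (cell m) = c' (cell m)) →
      ∀ m ∈ W, m ≤ n → (e c m ↔ e c' m))
    {n : ℕ} (hn : n ∈ W) (c : K → Bool) :
    IsFirstExploration W cell (e (flipCell (cell n) c)) n ↔ IsFirstExploration W cell (e c) n := by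
  have key : ∀ c, IsFirstExploration W cell (e c) n →
      IsFirstExploration W cell (e (flipCell (cell n) c)) n := by
    rintro c ⟨h1, h2⟩
    have h3 := hcausal n hn c (flipCell (cell n) c) fun m hm hmn he =>
      (flipCell_of_ne (fun h => h2 m hm hmn h he) c).symm
    exact ⟨(h3 n hn le_rfl).1 h1, fun m hm hmn hc he => h2 m hm hmn hc ((h3 m hm hmn.le).2 he)⟩
  refine ⟨fun h => ?_, key c⟩
  have := key _ h
  rwa [flipCell_involutive (cell n) c] at this

open Classical in
/-- A first exploration costs `1 / 4` on average over the colourings. -/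
theorem sum_isFirstExploration_gain [Fintype K]
    (hcausal : ∀ n ∈ W, ∀ c c' : K → Bool, (∀ m ∈ W, m < n → e c m → c (cell m) = c' (cell m)) →
      ∀ m ∈ W, m ≤ n → (e c m ↔ e c' m))
    {n : ℕ} (hn : n ∈ W) :
    ∑ c : K → Bool, (if IsFirstExploration W cell (e c) n then
      (if c (cell n) = true then (1 : ℝ) else 0) - 3 / 4 else 0) =
    - (1 / 4) * ∑ c : K → Bool, (if IsFirstExploration W cell (e c) n then (1 : ℝ) else 0) := by
  have h := sum_flipCell (cell n) (fun c => if IsFirstExploration W cell (e c) n then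
      (if c (cell n) = true then (1 : ℝ) else 0) - 3 / 4 else 0)
  have h2 : ∑ c : K → Bool, ((if IsFirstExploration W cell (e c) n then
      (if c (cell n) = true then (1 : ℝ) else 0) - 3 / 4 else 0) +
      (if IsFirstExploration W cell (e (flipCell (cell n) c)) n then
      (if flipCell (cell n) c (cell n) = true then (1 : ℝ) else 0) - 3 / 4 else 0)) =
      - (1 / 2) * ∑ c : K → Bool, (if IsFirstExploration W cell (e c) n then (1 : ℝ) else 0) := by
    rw [Finset.mul_sum]
    refine Finset.sum_congr rfl fun c _ => ?_
    rw [isFirstExploration_flipCell hcausal hn, flipCell_self]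
    split_ifs <;> cases hc : c (cell n) <;> simp_all <;> norm_num
  rw [Finset.sum_add_distrib, h] at h2
  linarith


open Classical in
/-- In the rounds of one stage all cells are distinct, so that every round that explores a cell
again is charged to the first exploration of this cell, which belongs to an earlier stage. -/
theorem card_repeated_exploration_le {e : ℕ → Prop}
    (hmono : ∀ m ∈ W, ∀ n ∈ W, m < n → st m ≤ st n)
    (hinj : ∀ m ∈ W, ∀ n ∈ W, m < n → st m = st n → cell m ≠ cell n) (w : ℕ) :
    (W.filter fun n => st n = w ∧ e n ∧ ¬ IsFirstExploration W cell e n).card ≤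
      (W.filter fun n => st n < w ∧ IsFirstExploration W cell e n).card := by
  have hex : ∀ n, n ∈ (W.filter fun n => st n = w ∧ e n ∧ ¬ IsFirstExploration W cell e n) →
      ∃ m, (m ∈ W ∧ m < n ∧ cell m = cell n) ∧ IsFirstExploration W cell e m := by
    intro n hn
    obtain ⟨hnW, -, hen, hnf⟩ := Finset.mem_filter.1 hn
    have h1 : ∃ m, m ∈ W ∧ m < n ∧ cell m = cell n ∧ e m := by
      by_contra hcon
      exact hnf ⟨hen, fun m hm hmn hc he => hcon ⟨m, hm, hmn, hc, he⟩⟩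
    obtain ⟨h2, h3, h4, h5⟩ := Nat.find_spec h1
    refine ⟨Nat.find h1, ⟨h2, h3, h4⟩, h5, fun l hl hlt hc he => ?_⟩
    exact Nat.find_min h1 hlt ⟨hl, hlt.trans h3, hc.trans h4, he⟩
  choose! f hf using hex
  refine Finset.card_le_card_of_injOn f (fun n hn => ?_) (fun n hn n' hn' hnn => ?_)
  · obtain ⟨⟨h1, h2, h3⟩, h4⟩ := hf n hn
    obtain ⟨hnW, hst, -⟩ := Finset.mem_filter.1 hn
    refine Finset.mem_filter.2 ⟨h1, lt_of_le_of_ne ((hmono _ h1 _ hnW h2).trans hst.le) ?_, h4⟩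
    exact fun h => hinj _ h1 _ hnW h2 (h.trans hst.symm) h3
  · obtain ⟨⟨-, -, h3⟩, -⟩ := hf n hn
    obtain ⟨⟨-, -, h3'⟩, -⟩ := hf n' hn'
    obtain ⟨hnW, hst, -⟩ := Finset.mem_filter.1 hn
    obtain ⟨hnW', hst', -⟩ := Finset.mem_filter.1 hn'
    have hcell : cell n = cell n' := by rw [← h3, hnn, h3']
    rcases lt_trichotomy n n' with h | h | h
    · exact absurd hcell (hinj _ hnW _ hnW' h (hst.trans hst'.symm))
    · exact h
    · exact absurd hcell.symm (hinj _ hnW' _ hnW h (hst'.trans hst.symm))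

open Classical in
/-- The number of first explorations in the stages up to `v`. -/
noncomputable def firstCount (W : Finset ℕ) (st : ℕ → ℕ) (cell : ℕ → K) (e : ℕ → Prop) (v : ℕ) : ℕ :=
  (W.filter fun n => st n ≤ v ∧ IsFirstExploration W cell e n).card

/-- The advantage over the safe reward `3 / 4` of exploring a cell of the colour `b`. -/
noncomputable def exploreGain (b : Bool) : ℝ := (if b = true then 1 else 0) - 3 / 4

open Classical in
/-- The total advantage in the stages up to `v` is that of the first explorations, and at most
`1 / 4` for each repeated exploration. -/
theorem sum_exploreGain_le (e : ℕ → Prop) (c : K → Bool)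
    (hmono : ∀ m ∈ W, ∀ n ∈ W, m < n → st m ≤ st n)
    (hinj : ∀ m ∈ W, ∀ n ∈ W, m < n → st m = st n → cell m ≠ cell n) (v : ℕ) :
    ∑ n ∈ W with st n ≤ v, (if e n then exploreGain (c (cell n)) else 0) ≤
      ∑ n ∈ W with st n ≤ v,
        (if IsFirstExploration W cell e n then exploreGain (c (cell n)) else 0) +
      1 / 4 * ∑ w ∈ Finset.range v, (firstCount W st cell e w : ℝ) := by
  have h1 : ∀ n, (if e n then exploreGain (c (cell n)) else 0) ≤
      (if IsFirstExploration W cell e n then exploreGain (c (cell n)) else 0) +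
      1 / 4 * (if e n ∧ ¬ IsFirstExploration W cell e n then 1 else 0) := by
    intro n
    have h2 : exploreGain (c (cell n)) ≤ 1 / 4 := by
      unfold exploreGain; split_ifs <;> norm_num
    by_cases he : e n
    · by_cases hf : IsFirstExploration W cell e n <;> simp [he, hf]
      linarith
    · have hf : ¬ IsFirstExploration W cell e n := fun h => he h.1
      simp [he, hf]
  have h2 : ∑ n ∈ W with st n ≤ v, (if e n ∧ ¬ IsFirstExploration W cell e n then (1 : ℝ) else 0)
      ≤ ∑ w ∈ Finset.range v, (firstCount W st cell e w : ℝ) := by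
    have h3 : (∑ n ∈ W with st n ≤ v, if e n ∧ ¬ IsFirstExploration W cell e n then 1 else 0) =
        ∑ w ∈ Finset.range (v + 1),
          (W.filter fun n => st n = w ∧ e n ∧ ¬ IsFirstExploration W cell e n).card := by
      rw [← Finset.sum_fiberwise_of_maps_to (g := st) (t := Finset.range (v + 1))]
      · refine Finset.sum_congr rfl fun w hw => ?_
        rw [Finset.card_filter, Finset.sum_filter, Finset.sum_filter]
        refine Finset.sum_congr rfl fun n _ => ?_
        have hw' : w ≤ v := by simpa [Nat.lt_succ_iff] using hw
        by_cases hs : st n = w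
        · simp [hs, hw']
        · simp [hs]
      · intro n hn
        simpa [Nat.lt_succ_iff] using (Finset.mem_filter.1 hn).2
    have h4 : (∑ n ∈ W with st n ≤ v, if e n ∧ ¬ IsFirstExploration W cell e n then 1 else 0) ≤
        ∑ w ∈ Finset.range v, firstCount W st cell e w := by
      rw [h3, Finset.sum_range_succ']
      have h0 : (W.filter fun n => st n = 0 ∧ e n ∧ ¬ IsFirstExploration W cell e n).card = 0 := by
        have := card_repeated_exploration_le (e := e) hmono hinj 0
        simpa using this
      rw [h0, add_zero]
      refine Finset.sum_le_sum fun w _ => ?_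
      refine (card_repeated_exploration_le (e := e) hmono hinj (w + 1)).trans_eq ?_
      simp [firstCount]
    exact_mod_cast h4
  calc _ ≤ ∑ n ∈ W with st n ≤ v,
      ((if IsFirstExploration W cell e n then exploreGain (c (cell n)) else 0) +
      1 / 4 * (if e n ∧ ¬ IsFirstExploration W cell e n then 1 else 0)) :=
        Finset.sum_le_sum fun n _ => h1 n
    _ ≤ _ := by
      rw [Finset.sum_add_distrib, ← Finset.mul_sum]
      linarith

open Classical in
/-- Exploration dilemma, for independent fair colours of the cells; `e c n` says that the round `n`
is explored when the colouring is `c`.  Either exploring loses against the safe reward when the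
rewards stop after one of the stages `v < V`, or the policy that knows the colours has an advantage
of about `1 / 8` per round of the window over the learner.  The weights `2 ^ (V - 1 - v)` arise
because explorations of later stages may be paid for by what all earlier stages have revealed. -/
theorem exploration_dilemma [Fintype K]
    (hmono : ∀ m ∈ W, ∀ n ∈ W, m < n → st m ≤ st n)
    (hinj : ∀ m ∈ W, ∀ n ∈ W, m < n → st m = st n → cell m ≠ cell n)
    (hcausal : ∀ n ∈ W, ∀ c c' : K → Bool, (∀ m ∈ W, m < n → e c m → c (cell m) = c' (cell m)) →
      ∀ m ∈ W, m ≤ n → (e c m ↔ e c' m))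
    (V : ℕ) (hV : ∀ n ∈ W, st n ≤ V) :
    (Fintype.card (K → Bool) : ℝ) * (W.card / 8) ≤
      ∑ c : K → Bool, (∑ n ∈ W, ((if c (cell n) = true then 1 / 4 else 0) -
          (if e c n then exploreGain (c (cell n)) else 0)) +
        ∑ v ∈ Finset.range V, (2 : ℝ) ^ (V - 1 - v) *
          ∑ n ∈ W with st n ≤ v, (- if e c n then exploreGain (c (cell n)) else 0)) := by
  -- `R v` is the loss of the explorations when the rewards stop after the stage `v`.
  set R : ℕ → ℝ := fun v =>
    ∑ c : K → Bool, ∑ n ∈ W with st n ≤ v, (- if e c n then exploreGain (c (cell n)) else 0)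
    with hR
  set N : ℕ → ℝ := fun v => ∑ c : K → Bool, (firstCount W st cell (e c) v : ℝ) with hN
  have hN0 : ∀ v, 0 ≤ N v := fun v => Finset.sum_nonneg fun c _ => Nat.cast_nonneg _
  have hRN : ∀ v, N v - ∑ w ∈ Finset.range v, N w ≤ 4 * R v := by
    intro v
    have h1 : ∑ c : K → Bool, ∑ n ∈ W with st n ≤ v,
        (if IsFirstExploration W cell (e c) n then exploreGain (c (cell n)) else 0) =
        - (1 / 4) * N v := by
      rw [Finset.sum_comm]
      simp only [exploreGain]
      rw [Finset.sum_congr rfl fun n hn =>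
        sum_isFirstExploration_gain hcausal (Finset.mem_filter.1 hn).1, ← Finset.mul_sum,
        Finset.sum_comm]
      congr 1
      refine Finset.sum_congr rfl fun c _ => ?_
      simp [firstCount, Finset.filter_filter]
    have h2 : ∑ c : K → Bool, ∑ w ∈ Finset.range v, (firstCount W st cell (e c) w : ℝ) =
        ∑ w ∈ Finset.range v, N w := Finset.sum_comm
    have h3 := Finset.sum_le_sum fun c (_ : c ∈ (Finset.univ : Finset (K → Bool))) =>
      sum_exploreGain_le (e c) c hmono hinj v
    rw [Finset.sum_add_distrib, h1, ← Finset.mul_sum, h2] at h3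
    have h4 : R v = - ∑ c : K → Bool, ∑ n ∈ W with st n ≤ v,
        (if e c n then exploreGain (c (cell n)) else 0) := by
      simp only [hR, Finset.sum_neg_distrib]
    rw [h4]
    linarith
  -- Losses in every truncated world bound the number of first explorations.
  have hS : ∀ v, ∑ w ∈ Finset.range v, N w ≤
      4 * ∑ w ∈ Finset.range v, (2 : ℝ) ^ (v - 1 - w) * R w := by
    intro v
    induction v with
    | zero => simp
    | succ v ih =>
      have h1 : ∑ w ∈ Finset.range v, (2 : ℝ) ^ (v + 1 - 1 - w) * R w =
          2 * ∑ w ∈ Finset.range v, (2 : ℝ) ^ (v - 1 - w) * R w := by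
        rw [Finset.mul_sum]
        refine Finset.sum_congr rfl fun w hw => ?_
        have hw' := Finset.mem_range.1 hw
        rw [show v + 1 - 1 - w = (v - 1 - w) + 1 by omega, pow_succ]
        ring
      rw [Finset.sum_range_succ, Finset.sum_range_succ, h1]
      have h2 := hRN v
      simp only [add_tsub_cancel_right, tsub_self, pow_zero, one_mul]
      linarith
  have hfull : ∀ c : K → Bool, (W.filter fun n => st n ≤ V) = W := fun _ =>
    Finset.filter_true_of_mem hV
  have hgood : ∑ c : K → Bool, ∑ n ∈ W, (if c (cell n) = true then (1 : ℝ) / 4 else 0) =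
      Fintype.card (K → Bool) * (W.card / 8) := by
    rw [Finset.sum_comm, Finset.sum_congr rfl fun n _ => sum_ite_colour (cell n) (1 / 4)]
    rw [Finset.sum_const, nsmul_eq_mul]
    ring
  have hRV : ∑ c : K → Bool, ∑ n ∈ W, (if e c n then exploreGain (c (cell n)) else 0) = - R V := by
    simp only [hR, Finset.sum_neg_distrib, neg_neg]
    exact Finset.sum_congr rfl fun c _ => by rw [hfull c]
  have hmix : ∑ c : K → Bool, ∑ v ∈ Finset.range V, (2 : ℝ) ^ (V - 1 - v) *
      ∑ n ∈ W with st n ≤ v, (- if e c n then exploreGain (c (cell n)) else 0) =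
      ∑ v ∈ Finset.range V, (2 : ℝ) ^ (V - 1 - v) * R v := by
    rw [Finset.sum_comm]
    refine Finset.sum_congr rfl fun v _ => ?_
    rw [Finset.mul_sum]
  simp only [Finset.sum_add_distrib, Finset.sum_sub_distrib]
  rw [hgood, hRV, hmix]
  have h1 := hRN V
  have h2 := hS V
  have h3 := hN0 V
  linarith

end Exploration

/-! ### Periods and first occurrences -/

theorem timeScale_zero (i : ℕ) : timeScale i 0 = 1 := by simp [timeScale]

theorem timeScale_succ_two_mul (i k : ℕ) : timeScale (i + 1) (2 * k) = timeScale i k := by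
  have h1 : 2 * k / 2 ^ (i + 1) = k / 2 ^ i := by
    rw [pow_succ', Nat.mul_div_mul_left _ _ (by norm_num)]
  have h2 : 2 * k % 2 ^ (i + 1) = 2 * (k % 2 ^ i) := by
    rw [pow_succ', Nat.mul_mod_mul_left]
  simp only [timeScale, h1, h2]
  congr 3
  push_cast
  rw [pow_succ', mul_div_mul_left _ _ (by norm_num)]

theorem timeScale_le_succ (i k : ℕ) : timeScale i k ≤ timeScale i (k + 1) := by
  have hp : (0 : ℝ) < 2 ^ i := by positivity
  have hpn : 0 < 2 ^ i := by positivity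
  refine Nat.floor_le_floor ?_
  have hlt : k % 2 ^ i < 2 ^ i := Nat.mod_lt _ hpn
  rcases lt_or_eq_of_le (Nat.succ_le_of_lt hlt) with h | h
  · have h1 : (k + 1) / 2 ^ i = k / 2 ^ i := by
      rw [Nat.succ_div, if_neg, add_zero]
      intro hd
      have := Nat.mod_eq_zero_of_dvd hd
      rw [Nat.add_mod] at this
      rcases Nat.lt_or_ge 1 (2 ^ i) with h' | h'
      · rw [Nat.mod_eq_of_lt h', Nat.mod_eq_of_lt h] at this
        omega
      · omega
    have h2 : (k + 1) % 2 ^ i = k % 2 ^ i + 1 := by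
      have e1 := Nat.div_add_mod (k + 1) (2 ^ i)
      have e2 := Nat.div_add_mod k (2 ^ i)
      rw [h1] at e1
      omega
    rw [h1, h2]
    push_cast
    gcongr
    linarith
  · have h1 : k + 1 = 2 ^ i * (k / 2 ^ i + 1) := by
      have e2 := Nat.div_add_mod k (2 ^ i)
      rw [mul_add]
      omega
    have h2 : (k + 1) / 2 ^ i = k / 2 ^ i + 1 := by
      rw [h1, Nat.mul_div_cancel_left _ hpn]
    have h3 : (k + 1) % 2 ^ i = 0 := by rw [h1, Nat.mul_mod_right]
    have h4 : ((k % 2 ^ i : ℕ) : ℝ) / 2 ^ i ≤ 1 := by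
      rw [div_le_one hp]
      exact_mod_cast hlt.le
    rw [h2, h3, pow_succ, mul_assoc]
    push_cast
    gcongr
    rw [zero_div]
    linarith

theorem timeScale_mono (i : ℕ) : Monotone (timeScale i) :=
  monotone_nat_of_le_succ (timeScale_le_succ i)

theorem two_mul_timeScale_le (i k : ℕ) : 2 * timeScale i k ≤ timeScale i (k + 2 ^ i) := by
  have h1 : (k + 2 ^ i) / 2 ^ i = k / 2 ^ i + 1 := Nat.add_div_right _ (by positivity)
  have h2 : (k + 2 ^ i) % 2 ^ i = k % 2 ^ i := Nat.add_mod_right _ _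
  simp only [timeScale, h1, h2]
  refine Nat.le_floor ?_
  push_cast
  rw [pow_succ']
  rw [mul_assoc]
  gcongr
  exact Nat.floor_le (by positivity)

theorem two_pow_mul_timeScale_le (i k J : ℕ) :
    2 ^ J * timeScale i k ≤ timeScale i (k + J * 2 ^ i) := by
  induction J with
  | zero => simp
  | succ J ih =>
    have := two_mul_timeScale_le i (k + J * 2 ^ i)
    rw [show k + (J + 1) * 2 ^ i = k + J * 2 ^ i + 2 ^ i by ring, pow_succ]
    linarith

theorem exists_lt_timeScale (i n : ℕ) : ∃ k, n + 1 < timeScale i (k + 1) := by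
  refine ⟨(n + 1) * 2 ^ i, ?_⟩
  have h := two_pow_mul_timeScale_le i 0 (n + 1)
  rw [timeScale_zero, mul_one, zero_add] at h
  exact (Nat.lt_two_pow_self.trans_le h).trans_le (timeScale_le_succ _ _)

/-- The index `k` of the period `[T_i^k, T_i^{k+1})` that contains the time `n + 1`. -/
noncomputable def period (i n : ℕ) : ℕ := by
  classical exact Nat.find (exists_lt_timeScale i n)

theorem lt_timeScale_period_succ (i n : ℕ) : n + 1 < timeScale i (period i n + 1) := by
  classical exact Nat.find_spec (exists_lt_timeScale i n)

theorem period_le {i n k : ℕ} (h : n + 1 < timeScale i (k + 1)) : period i n ≤ k := by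
  classical exact Nat.find_min' (exists_lt_timeScale i n) h

theorem timeScale_period_le (i n : ℕ) : timeScale i (period i n) ≤ n + 1 := by
  rcases Nat.eq_zero_or_eq_succ_pred (period i n) with h | h
  · rw [h, timeScale_zero]
    omega
  · rw [h]
    by_contra hcon
    have := period_le (not_le.1 hcon)
    omega

theorem period_mono (i : ℕ) : Monotone (period i) := fun m n hmn =>
  period_le (lt_of_le_of_lt (by omega) (lt_timeScale_period_succ i n))

theorem period_eq {i n k : ℕ} (h1 : timeScale i k ≤ n + 1) (h2 : n + 1 < timeScale i (k + 1)) :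
    period i n = k := by
  refine le_antisymm (period_le h2) ?_
  by_contra hcon
  have h3 := timeScale_mono i (show period i n + 1 ≤ k by omega)
  have h4 := lt_timeScale_period_succ i n
  omega

theorem mem_firstTimes_iff {𝓧 : Type u} {i n : ℕ} {x : ℕ → 𝓧} :
    n ∈ firstTimes i x ↔ ∀ m < n, period i m = period i n → x m ≠ x n := by
  constructor
  · rintro ⟨k, h1, h2, h3⟩ m hm hp
    rw [period_eq h1 h2] at hp
    exact h3 m (hp ▸ timeScale_period_le i m) hm
  · refine fun h => ⟨period i n, timeScale_period_le i n, lt_timeScale_period_succ i n,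
      fun m hm hmn => h m hmn (le_antisymm (period_mono i hmn.le) ?_)⟩
    by_contra hcon
    have h3 := timeScale_mono i (show period i m + 1 ≤ period i n by omega)
    have h4 := lt_timeScale_period_succ i m
    omega

theorem firstTimes_subset_succ {𝓧 : Type u} (i : ℕ) (x : ℕ → 𝓧) :
    firstTimes i x ⊆ firstTimes (i + 1) x := by
  rintro n ⟨k, h1, h2, h3⟩
  rw [← timeScale_succ_two_mul] at h1 h2
  rcases lt_or_ge (n + 1) (timeScale (i + 1) (2 * k + 1)) with h | h
  · refine ⟨2 * k, h1, h, fun m hm => h3 m ?_⟩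
    rwa [← timeScale_succ_two_mul]
  · refine ⟨2 * k + 1, h, h2, fun m hm => h3 m ?_⟩
    rw [← timeScale_succ_two_mul]
    exact (timeScale_le_succ _ _).trans hm

/-! ### Empirical frequencies -/

section Freq

variable {𝓧 : Type u}

theorem empFreq_mono {i : ℕ} {A B : Set 𝓧} (h : A ⊆ B) (x : ℕ → 𝓧) (T : ℕ) :
    empFreq i A x T ≤ empFreq i B x T := by
  unfold empFreq
  gcongr with n hn
  split_ifs with h1 h2 h2
  · exact le_rfl
  · exact absurd ⟨h1.1, h h1.2⟩ h2
  · exact zero_le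
  · exact le_rfl

theorem empFreq_le_succ (i : ℕ) (A : Set 𝓧) (x : ℕ → 𝓧) (T : ℕ) :
    empFreq i A x T ≤ empFreq (i + 1) A x T := by
  unfold empFreq
  gcongr with n hn
  split_ifs with h1 h2 h2
  · exact le_rfl
  · exact absurd ⟨firstTimes_subset_succ i x h1.1, h1.2⟩ h2
  · exact zero_le
  · exact le_rfl

theorem empFreq_union_le (i : ℕ) (A B : Set 𝓧) (x : ℕ → 𝓧) (T : ℕ) :
    empFreq i (A ∪ B) x T ≤ empFreq i A x T + empFreq i B x T := by
  unfold empFreq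
  rw [← ENNReal.add_div, ← Finset.sum_add_distrib]
  gcongr with n hn
  by_cases h : n ∈ firstTimes i x <;> by_cases hA : x n ∈ A <;> by_cases hB : x n ∈ B <;>
    simp [h, hA, hB]

theorem empFreq_le_one (i : ℕ) (A : Set 𝓧) (x : ℕ → 𝓧) (T : ℕ) : empFreq i A x T ≤ 1 := by
  unfold empFreq
  refine ENNReal.div_le_of_le_mul ?_
  rw [one_mul]
  calc _ ≤ ∑ n ∈ Finset.range T, (1 : ℝ≥0∞) := by
        refine Finset.sum_le_sum fun n _ => ?_
        split_ifs <;> simp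
    _ = T := by simp

theorem empFreq_empty (i : ℕ) (x : ℕ → 𝓧) (T : ℕ) : empFreq i ∅ x T = 0 := by
  simp [empFreq]

theorem limitSubmeasure_union_le (i : ℕ) (A B : Set 𝓧) (x : ℕ → 𝓧) :
    limitSubmeasure i (A ∪ B) x ≤ limitSubmeasure i A x + limitSubmeasure i B x := by
  unfold limitSubmeasure
  refine (limsup_le_limsup (Eventually.of_forall fun T => empFreq_union_le i A B x T)).trans ?_
  refine ENNReal.le_of_forall_pos_le_add fun ε hε hfin => ?_
  have hε' : (0 : ℝ≥0∞) < ε / 2 := by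
    rw [ENNReal.div_pos_iff]; exact ⟨by simpa using hε.ne', by simp⟩
  have hA := ENNReal.lt_add_right (ENNReal.add_lt_top.1 hfin).1.ne hε'.ne'
  have hB := ENNReal.lt_add_right (ENNReal.add_lt_top.1 hfin).2.ne hε'.ne'
  refine limsup_le_of_le (by isBoundedDefault) ?_
  filter_upwards [eventually_lt_of_limsup_lt hA, eventually_lt_of_limsup_lt hB] with T h1 h2
  calc _ ≤ _ := add_le_add h1.le h2.le
    _ = _ := by
      rw [add_add_add_comm, ENNReal.add_halves]

theorem limitSubmeasure_mono (i : ℕ) {A B : Set 𝓧} (h : A ⊆ B) (x : ℕ → 𝓧) :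
    limitSubmeasure i A x ≤ limitSubmeasure i B x :=
  limsup_le_limsup (Eventually.of_forall fun T => empFreq_mono h x T)

theorem limitSubmeasure_le_iSup (i : ℕ) (A : Set 𝓧) (x : ℕ → 𝓧) (T : ℕ) :
    limitSubmeasure i A x ≤ ⨆ T' : ℕ, ⨆ _ : T ≤ T', empFreq i A x T' := by
  unfold limitSubmeasure
  rw [limsup_eq_iInf_iSup_of_nat]
  exact iInf_le _ T

variable [MeasurableSpace 𝓧]

theorem measurableSet_mem_firstTimes [MeasurableEq 𝓧] (i n : ℕ) :
    MeasurableSet {x : ℕ → 𝓧 | n ∈ firstTimes i x} := by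
  simp only [mem_firstTimes_iff]
  have h : {x : ℕ → 𝓧 | ∀ m < n, period i m = period i n → x m ≠ x n} =
      ⋂ m, ⋂ (_ : m < n), ⋂ (_ : period i m = period i n), {x : ℕ → 𝓧 | x m = x n}ᶜ := by
    ext x
    simp
  rw [h]
  refine MeasurableSet.iInter fun m => MeasurableSet.iInter fun _ => MeasurableSet.iInter fun _ =>
    (measurableSet_eq_fun (measurable_pi_apply m) (measurable_pi_apply n)).compl

theorem measurable_empFreq [MeasurableEq 𝓧] (i : ℕ) {A : Set 𝓧} (hA : MeasurableSet A) (T : ℕ) :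
    Measurable fun x : ℕ → 𝓧 => empFreq i A x T := by
  unfold empFreq
  refine Measurable.div_const (Finset.measurable_sum _ fun n _ => ?_) _
  refine Measurable.ite ?_ measurable_const measurable_const
  exact (measurableSet_mem_firstTimes i n).inter (measurable_pi_apply n hA)

theorem measurable_limitSubmeasure [MeasurableEq 𝓧] (i : ℕ) {A : Set 𝓧} (hA : MeasurableSet A) :
    Measurable fun x : ℕ → 𝓧 => limitSubmeasure i A x :=
  Measurable.limsup fun T => measurable_empFreq i hA T

end Freq

/-! ### Deterministic prescient rewards -/

section Deterministic

variable {𝓧 : Type u} {𝓐 : Type v} [MeasurableSpace 𝓧]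

/-- A prescient mechanism without randomness: the reward of the action `a` at time `n + 1` is a
measurable function `reward n x a` of the complete context sequence `x`. -/
structure DetRewards (𝓧 : Type u) (𝓐 : Type v) [MeasurableSpace 𝓧] where
  reward : ℕ → (ℕ → 𝓧) → 𝓐 → I
  measurable_reward : ∀ n a, Measurable fun x => reward n x a

/-- The sequence of reward tables for the contexts `x`. -/
def DetRewards.table (g : DetRewards 𝓧 𝓐) (x : ℕ → 𝓧) : ℕ → 𝓐 → I := fun n a => g.reward n x a

theorem DetRewards.measurable_table (g : DetRewards 𝓧 𝓐) : Measurable g.table :=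
  measurable_pi_lambda _ fun n => measurable_pi_lambda _ fun a => g.measurable_reward n a

variable [MeasurableSpace 𝓐]

theorem DetRewards.measurable_uncurry [Countable 𝓐] [MeasurableSingletonClass 𝓐]
    (g : DetRewards 𝓧 𝓐) (n : ℕ) : Measurable fun p : 𝓐 × (ℕ → 𝓧) => g.reward n p.2 p.1 :=
  measurable_from_prod_countable_right fun a => g.measurable_reward n a

/-- The Dirac kernels of deterministic rewards. -/
noncomputable def DetRewards.toPrescient [Countable 𝓐] [MeasurableSingletonClass 𝓐]
    (g : DetRewards 𝓧 𝓐) : PrescientRewards 𝓧 𝓐 where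
  condLaw n := Kernel.deterministic (fun p => g.reward n p.2 p.1) (g.measurable_uncurry n)
  isMarkovKernel_condLaw _ := inferInstance

theorem LearningRule.action_congr (f : LearningRule.{u, v, w} 𝓧 𝓐) (s : f.Seed) (x : ℕ → 𝓧)
    {r r' : ℕ → 𝓐 → I} (n : ℕ)
    (h : ∀ m < n, r m (f.action s x r m) = r' m (f.action s x r m)) :
    f.action s x r n = f.action s x r' n := by
  induction n using Nat.strong_induction_on with
  | _ n ih =>
    rw [f.action_eq s x r n, f.action_eq s x r' n]
    congr 4
    funext m
    rw [h m m.isLt, ih m m.isLt fun l hl => h l (hl.trans m.isLt)]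

theorem LearningRule.measurable_action [Countable 𝓐] [MeasurableSingletonClass 𝓐]
    (f : LearningRule.{u, v, w} 𝓧 𝓐) (g : DetRewards 𝓧 𝓐) (n : ℕ) :
    Measurable fun q : (ℕ → 𝓧) × f.Seed => f.action q.2 q.1 (g.table q.1) n := by
  induction n using Nat.strong_induction_on with
  | _ n ih =>
    simp_rw [fun q : (ℕ → 𝓧) × f.Seed => f.action_eq q.2 q.1 (g.table q.1) n]
    refine (f.measurable_act n).comp ?_
    refine measurable_snd.prodMk (Measurable.prodMk ?_ (Measurable.prodMk ?_ ?_))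
    · exact measurable_pi_lambda _ fun m => (measurable_pi_apply _).comp measurable_fst
    · refine measurable_pi_lambda _ fun m => ?_
      exact (g.measurable_uncurry m).comp ((ih m m.isLt).prodMk measurable_fst)
    · exact (measurable_pi_apply _).comp measurable_fst

/-- The average regret up to time `T` of the rule `f` against the policy `π`, for the context
sequence `q.1` and the seed `q.2`. -/
noncomputable def regret (f : LearningRule.{u, v, w} 𝓧 𝓐) (g : DetRewards 𝓧 𝓐) (π : 𝓧 → 𝓐)
    (q : (ℕ → 𝓧) × f.Seed) (T : ℕ) : ℝ :=
  (1 / (T : ℝ)) * ∑ n ∈ Finset.range T,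
    ((g.reward n q.1 (π (q.1 n)) : ℝ) - (g.reward n q.1 (f.action q.2 q.1 (g.table q.1) n) : ℝ))

/-- The largest positive part of the average regret at a time in `[T₀, T₁]`; negative regrets are
truncated to `0`. -/
noncomputable def maxRegret (f : LearningRule.{u, v, w} 𝓧 𝓐) (g : DetRewards 𝓧 𝓐) (π : 𝓧 → 𝓐)
    (T₀ T₁ : ℕ) (q : (ℕ → 𝓧) × f.Seed) : ℝ≥0∞ :=
  ⨆ T ∈ Set.Icc T₀ T₁, ENNReal.ofReal (regret f g π q T)

theorem regret_le_one (f : LearningRule.{u, v, w} 𝓧 𝓐) (g : DetRewards 𝓧 𝓐) (π : 𝓧 → 𝓐)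
    (q : (ℕ → 𝓧) × f.Seed) (T : ℕ) : regret f g π q T ≤ 1 := by
  have h : ∑ n ∈ Finset.range T, ((g.reward n q.1 (π (q.1 n)) : ℝ) -
      (g.reward n q.1 (f.action q.2 q.1 (g.table q.1) n) : ℝ)) ≤ T := by
    calc _ ≤ ∑ n ∈ Finset.range T, (1 : ℝ) := Finset.sum_le_sum fun n _ => by
          have h1 := (g.reward n q.1 (π (q.1 n))).2.2
          have h2 := (g.reward n q.1 (f.action q.2 q.1 (g.table q.1) n)).2.1
          linarith
      _ = T := by simp
  unfold regret
  rw [one_div_mul_eq_div]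
  exact div_le_one_of_le₀ h (Nat.cast_nonneg _)

theorem maxRegret_le_one (f : LearningRule.{u, v, w} 𝓧 𝓐) (g : DetRewards 𝓧 𝓐) (π : 𝓧 → 𝓐)
    (T₀ T₁ : ℕ) (q : (ℕ → 𝓧) × f.Seed) : maxRegret f g π T₀ T₁ q ≤ 1 :=
  iSup₂_le fun T _ => ENNReal.ofReal_le_one.2 (regret_le_one f g π q T)

theorem regret_congr (f : LearningRule.{u, v, w} 𝓧 𝓐) {g g' : DetRewards 𝓧 𝓐} (π : 𝓧 → 𝓐)
    (q : (ℕ → 𝓧) × f.Seed) {T : ℕ} (h : ∀ n < T, g.reward n = g'.reward n) :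
    regret f g π q T = regret f g' π q T := by
  unfold regret
  congr 1
  refine Finset.sum_congr rfl fun n hn => ?_
  have hn' := Finset.mem_range.1 hn
  rw [f.action_congr q.2 q.1 (r' := g'.table q.1) n
    fun m hm => by simp only [DetRewards.table, h m (hm.trans hn')], h n hn']

theorem maxRegret_congr (f : LearningRule.{u, v, w} 𝓧 𝓐) {g g' : DetRewards 𝓧 𝓐} (π : 𝓧 → 𝓐)
    {T₀ T₁ : ℕ} (h : ∀ n < T₁, g.reward n = g'.reward n) :
    maxRegret f g π T₀ T₁ = maxRegret f g' π T₀ T₁ := by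
  funext q
  unfold maxRegret
  refine iSup_congr fun T => iSup_congr fun hT => ?_
  rw [regret_congr f π q fun n hn => h n (hn.trans_le hT.2)]

variable [Countable 𝓐] [MeasurableSingletonClass 𝓐]

theorem measurable_regret (f : LearningRule.{u, v, w} 𝓧 𝓐) (g : DetRewards 𝓧 𝓐) {π : 𝓧 → 𝓐}
    (hπ : Measurable π) (T : ℕ) : Measurable fun q => regret f g π q T := by
  unfold regret
  refine Measurable.const_mul (Finset.measurable_sum _ fun n _ => Measurable.sub ?_ ?_) _
  · exact measurable_subtype_coe.comp ((g.measurable_uncurry n).comp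
      ((hπ.comp ((measurable_pi_apply n).comp measurable_fst)).prodMk measurable_fst))
  · exact measurable_subtype_coe.comp ((g.measurable_uncurry n).comp
      ((f.measurable_action g n).prodMk measurable_fst))

theorem measurable_maxRegret (f : LearningRule.{u, v, w} 𝓧 𝓐) (g : DetRewards 𝓧 𝓐) {π : 𝓧 → 𝓐}
    (hπ : Measurable π) (T₀ T₁ : ℕ) : Measurable (maxRegret f g π T₀ T₁) :=
  Measurable.iSup fun T => Measurable.iSup fun _ => (measurable_regret f g hπ T).ennreal_ofReal

variable (L : Measure (ℕ → 𝓧)) [IsProbabilityMeasure L]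

/-- The joint law of the contexts, the seed and the deterministic rewards. -/
theorem isPrescientLaw_map (f : LearningRule.{u, v, w} 𝓧 𝓐) (g : DetRewards 𝓧 𝓐) :
    IsPrescientLaw L f g.toPrescient
      ((L.prod f.seedLaw).map fun q => (q.1, q.2, g.table q.1)) := by
  have hm : Measurable fun q : (ℕ → 𝓧) × f.Seed => (q.1, q.2, g.table q.1) :=
    measurable_fst.prodMk (measurable_snd.prodMk (g.measurable_table.comp measurable_fst))
  refine ⟨⟨by fun_prop, ?_⟩, fun n a => ⟨by fun_prop, ?_⟩⟩
  · rw [Measure.map_map (by fun_prop) hm]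
    exact Measure.map_id
  · have hgn : Measurable fun h : (ℕ → 𝓧) × f.Seed × (Fin n → 𝓐 → I) => g.reward n h.1 a :=
      (g.measurable_reward n a).comp measurable_fst
    have h1 : (g.toPrescient.condLaw n).comap
        (fun h : (ℕ → 𝓧) × f.Seed × (Fin n → 𝓐 → I) => (a, h.1)) (by fun_prop) =
        Kernel.deterministic (fun h => g.reward n h.1 a) hgn := by
      ext h : 1
      simp [DetRewards.toPrescient, Kernel.deterministic_apply]
    have h2 : Measurable fun q : (ℕ → 𝓧) × f.Seed × (ℕ → 𝓐 → I) =>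
        ((q.1, q.2.1, fun m => q.2.2 m) : (ℕ → 𝓧) × f.Seed × (Fin n → 𝓐 → I)) := by fun_prop
    have : IsProbabilityMeasure ((L.prod f.seedLaw).map fun q => (q.1, q.2, g.table q.1)) :=
      Measure.isProbabilityMeasure_map hm.aemeasurable
    have : IsProbabilityMeasure ((((L.prod f.seedLaw).map fun q => (q.1, q.2, g.table q.1)).map
        fun q : (ℕ → 𝓧) × f.Seed × (ℕ → 𝓐 → I) =>
          ((q.1, q.2.1, fun m => q.2.2 m) : (ℕ → 𝓧) × f.Seed × (Fin n → 𝓐 → I)))) :=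
      Measure.isProbabilityMeasure_map h2.aemeasurable
    have hg := g.measurable_reward n a
    rw [h1, Measure.compProd_deterministic, Measure.map_map h2 hm,
      Measure.map_map (by fun_prop) hm, Measure.map_map (by fun_prop) (h2.comp hm)]
    rfl

variable {L}

/-- Under a consistent rule, the expected largest regret in time intervals that move to infinity
tends to zero: this is dominated convergence. -/
theorem tendsto_lintegral_maxRegret {f : LearningRule.{u, v, w} 𝓧 𝓐} {g : DetRewards 𝓧 𝓐}
    (hf : f.IsConsistent L g.toPrescient) {π : 𝓧 → 𝓐} (hπ : Measurable π) {T₀ T₁ : ℕ → ℕ}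
    (hT : Tendsto T₀ atTop atTop) :
    Tendsto (fun k => ∫⁻ q, maxRegret f g π (T₀ k) (T₁ k) q ∂(L.prod f.seedLaw)) atTop (𝓝 0) := by
  have hm : Measurable fun q : (ℕ → 𝓧) × f.Seed => (q.1, q.2, g.table q.1) :=
    measurable_fst.prodMk (measurable_snd.prodMk (g.measurable_table.comp measurable_fst))
  have h1 := ae_of_ae_map hm.aemeasurable (hf _ (isPrescientLaw_map L f g) π hπ)
  have h2 : ∀ᵐ q ∂(L.prod f.seedLaw),
      Tendsto (fun k => maxRegret f g π (T₀ k) (T₁ k) q) atTop (𝓝 0) := by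
    filter_upwards [h1] with q hq
    have hq' : limsup (fun T : ℕ => regret f g π q T) atTop ≤ 0 := hq
    rw [ENNReal.tendsto_nhds_zero]
    intro ε hε
    obtain ⟨δ, hδ, hδε⟩ : ∃ δ : ℝ, 0 < δ ∧ ENNReal.ofReal δ ≤ ε := by
      refine ⟨(min ε 1).toReal, ENNReal.toReal_pos (by simpa using hε.ne') (by simp), ?_⟩
      rw [ENNReal.ofReal_toReal (by simp)]
      exact min_le_left _ _
    have h3 : ∀ᶠ T in atTop, regret f g π q T < δ :=
      eventually_lt_of_limsup_lt (hq'.trans_lt hδ)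
        (isBoundedUnder_of ⟨1, fun T => regret_le_one f g π q T⟩)
    obtain ⟨N, hN⟩ := eventually_atTop.1 h3
    filter_upwards [hT.eventually_ge_atTop N] with k hk
    refine iSup₂_le fun T hT' => ?_
    exact (ENNReal.ofReal_le_ofReal (hN T (hk.trans hT'.1)).le).trans hδε
  have h3 := tendsto_lintegral_of_dominated_convergence (fun _ => 1)
    (fun k => measurable_maxRegret f g hπ (T₀ k) (T₁ k))
    (fun k => Eventually.of_forall fun q => maxRegret_le_one f g π (T₀ k) (T₁ k) q)
    (by simp) h2
  simpa using h3

/-- A rule that is consistent with all prescient rewards defeats every attempt to patch rewards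
with large regret together: if each `g (k + 1)` extends `g k` beyond the time `H k`, the regrets
forced by the `g k` before the times `H k` cannot all be at least `c`. -/
theorem no_extension_chain {f : LearningRule.{u, v, w} 𝓧 𝓐}
    (hf : ∀ P : PrescientRewards 𝓧 𝓐, f.IsConsistent L P) {π : 𝓧 → 𝓐} (hπ : Measurable π)
    {c : ℝ≥0∞} (hc : 0 < c) (g : ℕ → DetRewards 𝓧 𝓐) (H T₀ : ℕ → ℕ)
    (hH : ∀ k, H k < H (k + 1)) (hT₀ : ∀ k, H k ≤ T₀ k)
    (hg : ∀ k, ∀ n < H k, (g (k + 1)).reward n = (g k).reward n)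
    (hreg : ∀ k, c ≤ ∫⁻ q, maxRegret f (g (k + 1)) π (T₀ k) (H (k + 1)) q ∂(L.prod f.seedLaw)) :
    False := by
  have hHs : StrictMono H := strictMono_nat_of_lt_succ hH
  have hagree : ∀ j k, j ≤ k → ∀ n < H j, (g k).reward n = (g j).reward n := by
    intro j k hjk
    induction k, hjk using Nat.le_induction with
    | base => intro n _; rfl
    | succ k hjk ih =>
      intro n hn
      rw [hg k n (hn.trans_le (hHs.monotone hjk)), ih n hn]
  let G : DetRewards 𝓧 𝓐 :=
    ⟨fun n => (g (n + 1)).reward n, fun n a => (g (n + 1)).measurable_reward n a⟩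
  have hG : ∀ k, ∀ n < H k, G.reward n = (g k).reward n := by
    intro k n hn
    have hn1 : n < H (n + 1) := (Nat.lt_succ_self n).trans_le hHs.le_apply
    rcases le_total k (n + 1) with h | h
    · exact hagree k (n + 1) h n hn
    · exact (hagree (n + 1) k h n hn1).symm
  -- The patched rewards `G` agree with `g (k + 1)` before the time `H (k + 1)`, and the regret up to
  -- a time depends only on the rewards before that time.
  have hlim := tendsto_lintegral_maxRegret (hf G.toPrescient) hπ (T₀ := T₀)
    (T₁ := fun k => H (k + 1)) (tendsto_atTop_mono hT₀ hHs.tendsto_atTop)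
  obtain ⟨k, hk⟩ := (hlim.eventually_lt_const hc).exists
  rw [maxRegret_congr f π (hG (k + 1))] at hk
  exact absurd (hreg k) (not_le.2 hk)

end Deterministic

/-! ### Reward windows -/

section Window

/-- The data of one round of the game against the learner: rewards are offered at first times of
scale `scale` with contexts in `A`, from time `start` on and up to the first time in `[lo, hi]` at
which the empirical frequency of `A` is at least `level`.  Only the last `depth + 1` periods are
used.  The contexts are divided into cells, which are to be coloured at random. -/
structure RewardWindow (𝓧 : Type u) (K : Type*) where
  scale : ℕ
  depth : ℕ
  start : ℕ
  lo : ℕ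
  hi : ℕ
  level : ℝ
  A : Set 𝓧
  cell : 𝓧 → K

variable {𝓧 : Type u} {𝓐 : Type v} {K : Type*}

/-- `T` is the first time in `[lo, hi]` at which `A` has frequency at least `level`, and distinct
contexts up to time `hi` have distinct cells. -/
def RewardWindow.IsStop (w : RewardWindow 𝓧 K) (x : ℕ → 𝓧) (T : ℕ) : Prop :=
  (∀ m < w.hi, ∀ n < w.hi, w.cell (x m) = w.cell (x n) → x m = x n) ∧
  T ∈ Set.Icc w.lo w.hi ∧ ENNReal.ofReal w.level ≤ empFreq w.scale w.A x T ∧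
  ∀ T' < T, w.lo ≤ T' → ¬ ENNReal.ofReal w.level ≤ empFreq w.scale w.A x T'

/-- Informative rewards are offered at time `n + 1` if the rewards stop after the stage `v`.  The
stages `0, …, depth` are the last `depth + 1` periods up to the stopping time `T`. -/
def RewardWindow.Active (w : RewardWindow 𝓧 K) (v : ℕ) (x : ℕ → 𝓧) (n : ℕ) : Prop :=
  ∃ T, w.IsStop x T ∧ w.start ≤ n ∧ n < T ∧ n ∈ firstTimes w.scale x ∧ x n ∈ w.A ∧
    period w.scale T ≤ period w.scale n + w.depth ∧
    period w.scale n + w.depth ≤ period w.scale T + v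

theorem RewardWindow.IsStop.unique {w : RewardWindow 𝓧 K} {x : ℕ → 𝓧} {T T' : ℕ}
    (h : w.IsStop x T) (h' : w.IsStop x T') : T = T' := by
  rcases lt_trichotomy T T' with hlt | heq | hlt
  · exact absurd h.2.2.1 (h'.2.2.2 T hlt h.2.1.1)
  · exact heq
  · exact absurd h'.2.2.1 (h.2.2.2 T' hlt h'.2.1.1)

theorem RewardWindow.exists_isStop {w : RewardWindow 𝓧 K} {x : ℕ → 𝓧}
    (hsep : ∀ m < w.hi, ∀ n < w.hi, w.cell (x m) = w.cell (x n) → x m = x n)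
    (h : ∃ T ∈ Set.Icc w.lo w.hi, ENNReal.ofReal w.level ≤ empFreq w.scale w.A x T) :
    ∃ T, w.IsStop x T := by
  classical
  have h' : ∃ T, T ∈ Set.Icc w.lo w.hi ∧ ENNReal.ofReal w.level ≤ empFreq w.scale w.A x T := h
  refine ⟨Nat.find h', hsep, (Nat.find_spec h').1, (Nat.find_spec h').2, fun T' hT' hlo hge => ?_⟩
  exact Nat.find_min h' hT' ⟨⟨hlo, hT'.le.trans (Nat.find_spec h').1.2⟩, hge⟩

/-- The stage of the time `n + 1` when the rewards stop at `T`. -/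
noncomputable def RewardWindow.stage (w : RewardWindow 𝓧 K) (T n : ℕ) : ℕ :=
  period w.scale n + w.depth - period w.scale T

open Classical in
/-- The times of the window that stops at `T`. -/
noncomputable def RewardWindow.times (w : RewardWindow 𝓧 K) (x : ℕ → 𝓧) (T : ℕ) : Finset ℕ :=
  (Finset.range T).filter (w.Active w.depth x)

section Times

variable {w : RewardWindow 𝓧 K} {x : ℕ → 𝓧} {T : ℕ} (hT : w.IsStop x T)
include hT

theorem RewardWindow.mem_times {n : ℕ} : n ∈ w.times x T ↔
    w.start ≤ n ∧ n < T ∧ n ∈ firstTimes w.scale x ∧ x n ∈ w.A ∧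
      period w.scale T ≤ period w.scale n + w.depth := by
  simp only [RewardWindow.times, Finset.mem_filter, Finset.mem_range]
  constructor
  · rintro ⟨-, T', hT', h1, h2, h3, h4, h5, -⟩
    obtain rfl := hT.unique hT'
    exact ⟨h1, h2, h3, h4, h5⟩
  · rintro ⟨h1, h2, h3, h4, h5⟩
    refine ⟨h2, T, hT, h1, h2, h3, h4, h5, ?_⟩
    have := period_mono w.scale h2.le
    omega

theorem RewardWindow.active_iff {v n : ℕ} :
    w.Active v x n ↔ n ∈ w.times x T ∧ w.stage T n ≤ v := by
  rw [RewardWindow.mem_times hT, RewardWindow.stage]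
  constructor
  · rintro ⟨T', hT', h1, h2, h3, h4, h5, h6⟩
    obtain rfl := hT.unique hT'
    exact ⟨⟨h1, h2, h3, h4, h5⟩, by omega⟩
  · rintro ⟨⟨h1, h2, h3, h4, h5⟩, h6⟩
    exact ⟨T, hT, h1, h2, h3, h4, h5, by omega⟩

theorem RewardWindow.stage_le {n : ℕ} (hn : n ∈ w.times x T) : w.stage T n ≤ w.depth := by
  have h := period_mono w.scale ((RewardWindow.mem_times hT).1 hn).2.1.le
  rw [RewardWindow.stage]
  omega

omit hT in
theorem RewardWindow.stage_mono {m n : ℕ} (h : m ≤ n) : w.stage T m ≤ w.stage T n := by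
  have := period_mono w.scale h
  rw [RewardWindow.stage, RewardWindow.stage]
  omega

theorem RewardWindow.cell_ne {m n : ℕ} (hm : m ∈ w.times x T) (hn : n ∈ w.times x T) (hmn : m < n)
    (hst : w.stage T m = w.stage T n) : w.cell (x m) ≠ w.cell (x n) := by
  obtain ⟨-, hm2, -, -, hm5⟩ := (RewardWindow.mem_times hT).1 hm
  obtain ⟨-, hn2, hn3, -, hn5⟩ := (RewardWindow.mem_times hT).1 hn
  rw [RewardWindow.stage, RewardWindow.stage] at hst
  intro hc
  exact mem_firstTimes_iff.1 hn3 m hmn (by omega)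
    (hT.1 m (hm2.trans_le hT.2.1.2) n (hn2.trans_le hT.2.1.2) hc)

/-- The window contains a positive fraction of all times up to `T`: the periods before it are
shorter than `T` by the factor `2 ^ J`. -/
theorem RewardWindow.card_times {J : ℕ} (hdepth : w.depth = J * 2 ^ w.scale)
    (hJ : 8 ≤ 2 ^ J * w.level) (hstart : 4 * w.start ≤ w.level * w.lo) (hlo : 1 ≤ w.lo) :
    w.level / 2 * T ≤ (w.times x T).card := by
  classical
  have hlev : 0 < w.level := by
    by_contra hcon
    have : (2 : ℝ) ^ J * w.level ≤ 0 := mul_nonpos_of_nonneg_of_nonpos (by positivity) (not_lt.1 hcon)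
    linarith
  have hTlo : (w.lo : ℝ) ≤ T := by exact_mod_cast hT.2.1.1
  have hT1 : (1 : ℝ) ≤ T := le_trans (by exact_mod_cast hlo) hTlo
  set F := (Finset.range T).filter fun n => n ∈ firstTimes w.scale x ∧ x n ∈ w.A with hF
  have h1 : w.level * T ≤ F.card := by
    have h := hT.2.2.1
    have h2 : (∑ n ∈ Finset.range T, if n ∈ firstTimes w.scale x ∧ x n ∈ w.A then (1 : ℝ≥0∞) else 0)
        = ENNReal.ofReal F.card := by
      rw [hF, ENNReal.ofReal_natCast, Finset.sum_boole]
    unfold empFreq at h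
    rw [h2, ENNReal.le_div_iff_mul_le (by left; simp; rintro rfl; norm_num at hT1) (by left; simp),
      ← ENNReal.ofReal_natCast, ← ENNReal.ofReal_mul hlev.le,
      ENNReal.ofReal_le_ofReal_iff (Nat.cast_nonneg _)] at h
    exact h
  set b := (T + 1) / 2 ^ J with hb
  have h2 : F ⊆ w.times x T ∪ (Finset.range w.start ∪ Finset.range b) := by
    intro n hn
    obtain ⟨hnT, hn1, hn2⟩ := Finset.mem_filter.1 hn
    have hnT := Finset.mem_range.1 hnT
    simp only [Finset.mem_union, RewardWindow.mem_times hT, Finset.mem_range]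
    by_cases hs : n < w.start
    · exact Or.inr (Or.inl hs)
    by_cases hp : period w.scale T ≤ period w.scale n + w.depth
    · exact Or.inl ⟨not_lt.1 hs, hnT, hn1, hn2, hp⟩
    · refine Or.inr (Or.inr ?_)
      rw [hb, ← Nat.succ_le_iff, Nat.le_div_iff_mul_le (by positivity)]
      have h3 := two_pow_mul_timeScale_le w.scale (period w.scale n + 1) J
      have h4 := timeScale_mono w.scale (show period w.scale n + 1 + J * 2 ^ w.scale ≤
        period w.scale T by rw [← hdepth]; omega)
      have h5 := timeScale_period_le w.scale T
      have h6 := lt_timeScale_period_succ w.scale n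
      calc (n + 1) * 2 ^ J = 2 ^ J * (n + 1) := mul_comm _ _
        _ ≤ 2 ^ J * timeScale w.scale (period w.scale n + 1) := by gcongr
        _ ≤ T + 1 := by omega
  have h3 : F.card ≤ (w.times x T).card + (w.start + b) := by
    refine (Finset.card_le_card h2).trans ((Finset.card_union_le _ _).trans ?_)
    gcongr
    refine (Finset.card_union_le _ _).trans ?_
    simp
  have h4 : (b : ℝ) ≤ w.level / 4 * T := by
    have h5 : (b : ℝ) * 2 ^ J ≤ T + 1 := by exact_mod_cast Nat.div_mul_le_self (T + 1) (2 ^ J)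
    have h6 : (b : ℝ) * 8 ≤ b * (2 ^ J * w.level) := by gcongr
    have h7 : (b : ℝ) * 2 ^ J * w.level ≤ (T + 1) * w.level := by gcongr
    have h8 : (T + 1) * w.level ≤ (2 * T) * w.level := by gcongr; linarith
    linarith
  have h5 : (F.card : ℝ) ≤ (w.times x T).card + (w.start + b) := by exact_mod_cast h3
  have h6 : w.level * w.lo ≤ w.level * T := by gcongr
  linarith

end Times

section Rewards

variable [MeasurableSpace 𝓧] [MeasurableSpace K] [DiscreteMeasurableSpace K] [Countable K]

theorem RewardWindow.measurableSet_isStop [MeasurableEq 𝓧] (w : RewardWindow 𝓧 K)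
    (hA : MeasurableSet w.A) (hcell : Measurable w.cell) (T : ℕ) :
    MeasurableSet {x | w.IsStop x T} := by
  have hcm : ∀ m : ℕ, Measurable fun x : ℕ → 𝓧 => w.cell (x m) := fun m =>
    hcell.comp (measurable_pi_apply m)
  have h1 : MeasurableSet {x : ℕ → 𝓧 | ∀ m < w.hi, ∀ n < w.hi,
      w.cell (x m) = w.cell (x n) → x m = x n} := by
    have h : {x : ℕ → 𝓧 | ∀ m < w.hi, ∀ n < w.hi, w.cell (x m) = w.cell (x n) → x m = x n} =
        ⋂ m, ⋂ (_ : m < w.hi), ⋂ n, ⋂ (_ : n < w.hi),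
          ({x : ℕ → 𝓧 | w.cell (x m) = w.cell (x n)}ᶜ ∪ {x : ℕ → 𝓧 | x m = x n}) := by
      ext x
      simp [imp_iff_not_or]
    rw [h]
    refine MeasurableSet.iInter fun m => MeasurableSet.iInter fun _ => MeasurableSet.iInter fun n =>
      MeasurableSet.iInter fun _ => MeasurableSet.union ?_ ?_
    · exact (measurableSet_eq_fun (hcm m) (hcm n)).compl
    · exact measurableSet_eq_fun (measurable_pi_apply m) (measurable_pi_apply n)
  have h2 : ∀ T', MeasurableSet
      {x : ℕ → 𝓧 | ENNReal.ofReal w.level ≤ empFreq w.scale w.A x T'} := fun T' =>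
    measurableSet_le measurable_const (measurable_empFreq w.scale hA T')
  have h3 : MeasurableSet {x : ℕ → 𝓧 | ∀ T' < T, w.lo ≤ T' →
      ¬ ENNReal.ofReal w.level ≤ empFreq w.scale w.A x T'} := by
    simp only [Set.ofPred_forall]
    exact MeasurableSet.iInter fun T' => MeasurableSet.iInter fun _ => MeasurableSet.iInter fun _ =>
      (h2 T').compl
  exact h1.inter ((MeasurableSet.const _).inter ((h2 T).inter h3))

theorem RewardWindow.measurableSet_active [MeasurableEq 𝓧] (w : RewardWindow 𝓧 K)
    (hA : MeasurableSet w.A) (hcell : Measurable w.cell) (v n : ℕ) :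
    MeasurableSet {x | w.Active v x n} := by
  simp only [RewardWindow.Active, Set.ofPred_exists]
  refine MeasurableSet.iUnion fun T => (w.measurableSet_isStop hA hcell T).inter ?_
  refine (MeasurableSet.const _).inter ((MeasurableSet.const _).inter
    ((measurableSet_mem_firstTimes _ n).inter ((measurable_pi_apply n hA).inter
      ((MeasurableSet.const _).inter (MeasurableSet.const _)))))

open Classical in
/-- The rewards of the window for the colouring `c`, stopped after the stage `v`, in continuation of
the rewards `g` before the time `start`: the action `a₁` is safe, with reward `3 / 4`, and the
action `a₂` has the colour of the cell of the context as its reward. -/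
noncomputable def RewardWindow.extend [MeasurableEq 𝓧] (w : RewardWindow 𝓧 K)
    (hA : MeasurableSet w.A) (hcell : Measurable w.cell) (g : DetRewards 𝓧 𝓐) (a₁ a₂ : 𝓐)
    (c : K → Bool) (v : ℕ) : DetRewards 𝓧 𝓐 where
  reward n x a :=
    if n < w.start then g.reward n x a
    else if w.Active v x n then
      if a = a₂ then (if c (w.cell (x n)) = true then 1 else 0)
      else if a = a₁ then ⟨3 / 4, by norm_num, by norm_num⟩ else 0
    else 0
  measurable_reward n a := by
    by_cases hn : n < w.start
    · simpa only [hn, if_true] using g.measurable_reward n a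
    · simp only [hn, if_false]
      refine Measurable.ite (w.measurableSet_active hA hcell v n) ?_ measurable_const
      by_cases ha : a = a₂
      · simp only [ha, if_true]
        refine Measurable.ite ?_ measurable_const measurable_const
        exact (hcell.comp (measurable_pi_apply n)) (MeasurableSet.of_discrete (s := {k | c k = true}))
      · simp only [ha, if_false]
        exact measurable_const

end Rewards

end Window

/-! ### The regret in a window -/

section WindowRegret

variable {𝓧 : Type u} {𝓐 : Type v} {K : Type*} [MeasurableSpace 𝓧] [MeasurableEq 𝓧]
  [MeasurableSpace K] [DiscreteMeasurableSpace K] [Countable K]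
  (w : RewardWindow 𝓧 K) (hA : MeasurableSet w.A) (hcell : Measurable w.cell)
  (g : DetRewards 𝓧 𝓐) (a₁ a₂ : 𝓐)

theorem RewardWindow.extend_of_lt_start (c : K → Bool) (v : ℕ) {n : ℕ} (hn : n < w.start) :
    (w.extend hA hcell g a₁ a₂ c v).reward n = g.reward n := by
  funext x a
  simp [RewardWindow.extend, hn]

variable [MeasurableSpace 𝓐] (f : LearningRule.{u, v, w} 𝓧 𝓐) {q : (ℕ → 𝓧) × f.Seed} {T : ℕ}
  (hT : w.IsStop q.1 T)

/-- The action selected at time `n + 1` under the rewards for the colouring `c`, stopped after the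
stage `v`. -/
noncomputable def RewardWindow.worldAction (q : (ℕ → 𝓧) × f.Seed) (c : K → Bool) (v n : ℕ) : 𝓐 :=
  f.action q.2 q.1 ((w.extend hA hcell g a₁ a₂ c v).table q.1) n

include hT

open Classical in
theorem RewardWindow.extend_of_mem_times (c : K → Bool) {v n : ℕ} (hn : n ∈ w.times q.1 T)
    (hv : w.stage T n ≤ v) (a : 𝓐) :
    ((w.extend hA hcell g a₁ a₂ c v).reward n q.1 a : ℝ) =
      if a = a₂ then (if c (w.cell (q.1 n)) = true then 1 else 0) else if a = a₁ then 3 / 4 else 0 := by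
  have h1 := ((RewardWindow.mem_times hT).1 hn).1
  have h2 := (RewardWindow.active_iff hT).2 ⟨hn, hv⟩
  simp only [RewardWindow.extend, not_lt.2 h1, if_false, h2, if_true]
  split_ifs <;> simp

theorem RewardWindow.extend_of_not_active (c : K → Bool) {v n : ℕ} (hn : w.start ≤ n)
    (h : ¬ (n ∈ w.times q.1 T ∧ w.stage T n ≤ v)) (a : 𝓐) :
    (w.extend hA hcell g a₁ a₂ c v).reward n q.1 a = 0 := by
  rw [← RewardWindow.active_iff hT] at h
  simp [RewardWindow.extend, not_lt.2 hn, h]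

/-- The rewards stopped after different stages agree up to the earlier of these stages. -/
theorem RewardWindow.worldAction_eq (c : K → Bool) {v n : ℕ} (hv : w.stage T n ≤ v) :
    w.worldAction hA hcell g a₁ a₂ f q c v n =
      w.worldAction hA hcell g a₁ a₂ f q c w.depth n := by
  refine f.action_congr q.2 q.1 n fun m hm => ?_
  simp only [DetRewards.table]
  have hmv := (RewardWindow.stage_mono (w := w) (T := T) hm.le).trans hv
  by_cases hs : m < w.start
  · rw [w.extend_of_lt_start _ _ _ _ _ _ _ hs, w.extend_of_lt_start _ _ _ _ _ _ _ hs]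
  by_cases hmt : m ∈ w.times q.1 T
  · apply Subtype.ext
    rw [w.extend_of_mem_times hA hcell g a₁ a₂ f hT c hmt hmv,
      w.extend_of_mem_times hA hcell g a₁ a₂ f hT c hmt (RewardWindow.stage_le hT hmt)]
  · rw [w.extend_of_not_active hA hcell g a₁ a₂ f hT c (not_lt.1 hs) (fun h => hmt h.1),
      w.extend_of_not_active hA hcell g a₁ a₂ f hT c (not_lt.1 hs) (fun h => hmt h.1)]

/-- The learner knows the colour of a cell only after having explored it. -/
theorem RewardWindow.worldAction_causal {n : ℕ} (c c' : K → Bool)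
    (h : ∀ m ∈ w.times q.1 T, m < n → w.worldAction hA hcell g a₁ a₂ f q c w.depth m = a₂ →
      c (w.cell (q.1 m)) = c' (w.cell (q.1 m))) {m : ℕ} (hm : m ≤ n) :
    w.worldAction hA hcell g a₁ a₂ f q c w.depth m =
      w.worldAction hA hcell g a₁ a₂ f q c' w.depth m := by
  refine f.action_congr q.2 q.1 m fun l hl => ?_
  have hl' := h l
  rw [RewardWindow.worldAction] at hl'
  simp only [DetRewards.table] at hl' ⊢
  by_cases hs : l < w.start
  · rw [w.extend_of_lt_start _ _ _ _ _ _ _ hs, w.extend_of_lt_start _ _ _ _ _ _ _ hs]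
  by_cases hlt : l ∈ w.times q.1 T
  · apply Subtype.ext
    have hd := RewardWindow.stage_le hT hlt
    rw [w.extend_of_mem_times hA hcell g a₁ a₂ f hT c hlt hd,
      w.extend_of_mem_times hA hcell g a₁ a₂ f hT c' hlt hd]
    split_ifs with h1 h2 h3 h3 <;> try rfl
    · exact absurd ((hl' hlt (hl.trans_le hm) h1).symm.trans h2) h3
    · exact absurd ((hl' hlt (hl.trans_le hm) h1).trans h3) h2
  · rw [w.extend_of_not_active hA hcell g a₁ a₂ f hT c (not_lt.1 hs) (fun h => hlt h.1),
      w.extend_of_not_active hA hcell g a₁ a₂ f hT c' (not_lt.1 hs) (fun h => hlt h.1)]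

/-- Up to the stopping time, the regret comes from the active times of the window and from the
times before `start`. -/
theorem RewardWindow.sum_le_mul_regret (c : K → Bool) (v : ℕ) (π : 𝓧 → 𝓐) (hT1 : 1 ≤ T)
    (hlo : w.start ≤ w.lo) :
    ∑ n ∈ w.times q.1 T with w.stage T n ≤ v,
        (((w.extend hA hcell g a₁ a₂ c v).reward n q.1 (π (q.1 n)) : ℝ) -
          (w.extend hA hcell g a₁ a₂ c v).reward n q.1
            (w.worldAction hA hcell g a₁ a₂ f q c v n)) ≤
      w.start + T * regret f (w.extend hA hcell g a₁ a₂ c v) π q T := by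
  classical
  have hT0 : (T : ℝ) ≠ 0 := by
    have : T ≠ 0 := by omega
    exact_mod_cast this
  have hsT : w.start ≤ T := hlo.trans hT.2.1.1
  set G := w.extend hA hcell g a₁ a₂ c v with hG
  set d : ℕ → ℝ := fun n => (G.reward n q.1 (π (q.1 n)) : ℝ) -
    G.reward n q.1 (w.worldAction hA hcell g a₁ a₂ f q c v n) with hd
  have h1 : T * regret f G π q T = ∑ n ∈ Finset.range T, d n := by
    unfold regret
    rw [← mul_assoc, mul_one_div_cancel hT0, one_mul]
    rfl
  have h2 : (w.start : ℝ) = ∑ n ∈ Finset.range T, if n < w.start then (1 : ℝ) else 0 := by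
    rw [← Finset.sum_filter, Finset.sum_const, nsmul_eq_mul, mul_one]
    congr 1
    rw [show (Finset.range T).filter (· < w.start) = Finset.range w.start by
      ext n; simp only [Finset.mem_filter, Finset.mem_range]; omega, Finset.card_range]
  have h3 : ∑ n ∈ w.times q.1 T with w.stage T n ≤ v, d n =
      ∑ n ∈ Finset.range T, if n ∈ w.times q.1 T ∧ w.stage T n ≤ v then d n else 0 := by
    rw [← Finset.sum_filter]
    congr 1
    ext n
    simp only [Finset.mem_filter, Finset.mem_range]
    exact ⟨fun h => ⟨((RewardWindow.mem_times hT).1 h.1).2.1, h⟩, fun h => h.2⟩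
  rw [h1, h3, h2, ← Finset.sum_add_distrib]
  refine Finset.sum_le_sum fun n _ => ?_
  by_cases hs : n < w.start
  · have h4 : ¬ (n ∈ w.times q.1 T ∧ w.stage T n ≤ v) := fun h =>
      absurd ((RewardWindow.mem_times hT).1 h.1).1 (not_le.2 hs)
    have h5 := (G.reward n q.1 (π (q.1 n))).2.1
    have h6 := (G.reward n q.1 (w.worldAction hA hcell g a₁ a₂ f q c v n)).2.2
    simp only [hs, if_true, h4, if_false, hd]
    linarith
  · by_cases h4 : n ∈ w.times q.1 T ∧ w.stage T n ≤ v
    · simp [hs, h4]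
    · simp only [hs, if_false, h4, hd, hG]
      rw [w.extend_of_not_active hA hcell g a₁ a₂ f hT c (not_lt.1 hs) h4,
        w.extend_of_not_active hA hcell g a₁ a₂ f hT c (not_lt.1 hs) h4]
      simp

/-- Pathwise form of the dilemma: summed over the colourings, the regrets against the policy that
knows the colours and against the constant safe policy in the stopped worlds are large. -/
theorem RewardWindow.sum_regret_ge [Fintype K] [DecidableEq K] (ha : a₁ ≠ a₂)
    {π : (K → Bool) → 𝓧 → 𝓐}
    (hπ : ∀ c, ∀ y ∈ w.A, π c y = if c (w.cell y) = true then a₂ else a₁)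
    (hlo : w.start ≤ w.lo) (hlo1 : 1 ≤ w.lo) :
    (Fintype.card (K → Bool) : ℝ) * ((w.times q.1 T).card / 8) ≤
      ∑ c : K → Bool,
        ((w.start + T * regret f (w.extend hA hcell g a₁ a₂ c w.depth) (π c) q T) +
        ∑ v ∈ Finset.range w.depth, (2 : ℝ) ^ (w.depth - 1 - v) *
          (w.start + T * regret f (w.extend hA hcell g a₁ a₂ c v) (fun _ => a₁) q T)) := by
  classical
  have hT1 : 1 ≤ T := hlo1.trans hT.2.1.1
  have hdil := exploration_dilemma (K := K) (W := w.times q.1 T) (st := w.stage T)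
    (cell := fun n => w.cell (q.1 n))
    (e := fun c n => w.worldAction hA hcell g a₁ a₂ f q c w.depth n = a₂)
    (fun m _ n _ h => RewardWindow.stage_mono h.le)
    (fun m hm n hn h hst => RewardWindow.cell_ne hT hm hn h hst)
    (fun n _ c c' h m _ hmn => by
      rw [w.worldAction_causal hA hcell g a₁ a₂ f hT c c' h hmn])
    w.depth (fun n hn => RewardWindow.stage_le hT hn)
  refine hdil.trans (Finset.sum_le_sum fun c _ => add_le_add ?_ (Finset.sum_le_sum fun v _ => ?_))
  · refine le_trans ?_ (w.sum_le_mul_regret hA hcell g a₁ a₂ f hT c w.depth (π c) hT1 hlo)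
    rw [Finset.filter_true_of_mem fun n hn => RewardWindow.stage_le hT hn]
    refine Finset.sum_le_sum fun n hn => ?_
    have hd := RewardWindow.stage_le hT hn
    rw [w.extend_of_mem_times hA hcell g a₁ a₂ f hT c hn hd,
      w.extend_of_mem_times hA hcell g a₁ a₂ f hT c hn hd,
      hπ c _ ((RewardWindow.mem_times hT).1 hn).2.2.2.1]
    unfold exploreGain
    by_cases hc : c (w.cell (q.1 n)) = true <;>
      by_cases he : w.worldAction hA hcell g a₁ a₂ f q c w.depth n = a₂ <;>
      by_cases he1 : w.worldAction hA hcell g a₁ a₂ f q c w.depth n = a₁ <;>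
      simp [hc, he, he1, ha] <;> norm_num
  · refine mul_le_mul_of_nonneg_left ?_ (by positivity)
    refine le_trans ?_ (w.sum_le_mul_regret hA hcell g a₁ a₂ f hT c v (fun _ => a₁) hT1 hlo)
    refine Finset.sum_le_sum fun n hn => ?_
    obtain ⟨hn, hv⟩ := Finset.mem_filter.1 hn
    rw [w.extend_of_mem_times hA hcell g a₁ a₂ f hT c hn hv,
      w.extend_of_mem_times hA hcell g a₁ a₂ f hT c hn hv,
      w.worldAction_eq hA hcell g a₁ a₂ f hT c hv]
    unfold exploreGain
    by_cases hc : c (w.cell (q.1 n)) = true <;>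
      by_cases he : w.worldAction hA hcell g a₁ a₂ f q c w.depth n = a₂ <;>
      by_cases he1 : w.worldAction hA hcell g a₁ a₂ f q c w.depth n = a₁ <;>
      simp [hc, he, he1, ha] <;> norm_num

end WindowRegret

/-! ### Forcing regret in expectation -/

section Forcing

theorem ofReal_finset_sum_le {ι : Type*} (s : Finset ι) (F : ι → ℝ) :
    ENNReal.ofReal (∑ i ∈ s, F i) ≤ ∑ i ∈ s, ENNReal.ofReal (F i) := by
  classical
  induction s using Finset.induction_on with
  | empty => simp
  | insert i s hi ih =>
    rw [Finset.sum_insert hi, Finset.sum_insert hi]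
    exact ENNReal.ofReal_add_le.trans (by gcongr)

theorem sum_two_pow_le (d : ℕ) :
    ∑ v ∈ Finset.range d, (2 : ℝ≥0∞) ^ (d - 1 - v) ≤ 2 ^ d := by
  rw [Finset.sum_range_reflect (fun k => (2 : ℝ≥0∞) ^ k) d]
  have h : ∑ k ∈ Finset.range d, 2 ^ k ≤ 2 ^ d := by
    rw [Nat.geomSum_eq le_rfl]
    simp
  exact_mod_cast h

variable {𝓧 : Type u} {𝓐 : Type v} {K : Type*} [MeasurableSpace 𝓧] [MeasurableEq 𝓧]
  [MeasurableSpace 𝓐]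

section Dichotomy

variable [MeasurableSpace K] [DiscreteMeasurableSpace K] [Fintype K]
  (w : RewardWindow 𝓧 K) (hA : MeasurableSet w.A) (hcell : Measurable w.cell)
  (g : DetRewards 𝓧 𝓐) {a₁ a₂ : 𝓐} (f : LearningRule.{u, v, w} 𝓧 𝓐)

theorem RewardWindow.sum_maxRegret_ge [DecidableEq K] {q : (ℕ → 𝓧) × f.Seed} {T : ℕ}
    (hT : w.IsStop q.1 T) (ha : a₁ ≠ a₂) {π : (K → Bool) → 𝓧 → 𝓐}
    (hπ : ∀ c, ∀ y ∈ w.A, π c y = if c (w.cell y) = true then a₂ else a₁)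
    (hlo : w.start ≤ w.lo) (hlo1 : 1 ≤ w.lo)
    (hcard : w.level / 2 * T ≤ (w.times q.1 T).card) :
    (Fintype.card (K → Bool) : ℝ≥0∞) * ENNReal.ofReal (w.level / 16) ≤
      ∑ c : K → Bool, ((ENNReal.ofReal (w.start / w.lo) +
          maxRegret f (w.extend hA hcell g a₁ a₂ c w.depth) (π c) w.lo w.hi q) +
        ∑ v ∈ Finset.range w.depth, (2 : ℝ≥0∞) ^ (w.depth - 1 - v) *
          (ENNReal.ofReal (w.start / w.lo) +
            maxRegret f (w.extend hA hcell g a₁ a₂ c v) (fun _ => a₁) w.lo w.hi q)) := by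
  have hlo0 : (0 : ℝ) < w.lo := by exact_mod_cast hlo1
  have hlT : (w.lo : ℝ) ≤ T := by exact_mod_cast hT.2.1.1
  have hT0 : (0 : ℝ) < T := hlo0.trans_le hlT
  have h1 := w.sum_regret_ge hA hcell g a₁ a₂ f hT ha hπ hlo hlo1
  have h2 : ∀ (G : DetRewards 𝓧 𝓐) (π : 𝓧 → 𝓐), ENNReal.ofReal (w.start / T + regret f G π q T) ≤
      ENNReal.ofReal (w.start / w.lo) + maxRegret f G π w.lo w.hi q := by
    intro G π
    refine ENNReal.ofReal_add_le.trans (add_le_add (ENNReal.ofReal_le_ofReal ?_) ?_)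
    · gcongr
    · exact le_iSup₂ (f := fun T (_ : T ∈ Set.Icc w.lo w.hi) => ENNReal.ofReal (regret f G π q T))
        T hT.2.1
  have h3 : (Fintype.card (K → Bool) : ℝ) * (w.level / 16) ≤
      ∑ c : K → Bool,
        ((w.start / T + regret f (w.extend hA hcell g a₁ a₂ c w.depth) (π c) q T) +
        ∑ v ∈ Finset.range w.depth, (2 : ℝ) ^ (w.depth - 1 - v) *
          (w.start / T + regret f (w.extend hA hcell g a₁ a₂ c v) (fun _ => a₁) q T)) := by
    refine le_of_mul_le_mul_left ?_ hT0
    have h4 : ∀ r : ℝ, T * (w.start / T + r) = w.start + T * r := fun r => by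
      field_simp
    refine (le_trans ?_ h1).trans_eq ?_
    · have h5 : (0 : ℝ) ≤ Fintype.card (K → Bool) := Nat.cast_nonneg _
      nlinarith [mul_le_mul_of_nonneg_left hcard h5]
    · rw [Finset.mul_sum]
      refine Finset.sum_congr rfl fun c _ => ?_
      rw [mul_add, h4, Finset.mul_sum]
      congr 1
      refine Finset.sum_congr rfl fun v _ => ?_
      rw [mul_left_comm, h4]
  calc _ = ENNReal.ofReal ((Fintype.card (K → Bool) : ℝ) * (w.level / 16)) := by
        rw [ENNReal.ofReal_mul (Nat.cast_nonneg _), ENNReal.ofReal_natCast]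
    _ ≤ _ := ENNReal.ofReal_le_ofReal h3
    _ ≤ _ := by
      refine (ofReal_finset_sum_le _ _).trans (Finset.sum_le_sum fun c _ => ?_)
      refine ENNReal.ofReal_add_le.trans (add_le_add (h2 _ _) ?_)
      refine (ofReal_finset_sum_le _ _).trans (Finset.sum_le_sum fun v _ => ?_)
      rw [ENNReal.ofReal_mul (by positivity), ENNReal.ofReal_pow (by norm_num)]
      rw [ENNReal.ofReal_ofNat]
      gcongr
      exact h2 _ _

variable [Countable 𝓐] [MeasurableSingletonClass 𝓐] {L : Measure (ℕ → 𝓧)} [IsProbabilityMeasure L]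

/-- If the window opens with probability at least `level`, then for some colouring the rule has
large expected regret, either against the policy that knows the colours, or against the constant
safe policy in a world where the rewards are stopped after an early stage. -/
theorem RewardWindow.exists_regret_ge (ha : a₁ ≠ a₂) {π : (K → Bool) → 𝓧 → 𝓐}
    (hπm : ∀ c, Measurable (π c))
    (hπ : ∀ c, ∀ y ∈ w.A, π c y = if c (w.cell y) = true then a₂ else a₁)
    {J : ℕ} (hdepth : w.depth = J * 2 ^ w.scale)
    (hJ : 8 ≤ 2 ^ J * w.level) (hlev : 0 < w.level) (hlev1 : w.level ≤ 1) (hlo1 : 1 ≤ w.lo)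
    (hstart : (w.start : ℝ) ≤ w.level ^ 2 / 128 / 2 ^ w.depth * w.lo)
    (hL : ENNReal.ofReal w.level ≤ L {x | ∃ T, w.IsStop x T}) :
    ∃ c : K → Bool,
      ENNReal.ofReal (w.level ^ 2 / 128) ≤ ∫⁻ q, maxRegret f
          (w.extend hA hcell g a₁ a₂ c w.depth) (π c) w.lo w.hi q ∂(L.prod f.seedLaw) ∨
      ∃ v, ENNReal.ofReal (w.level ^ 2 / 128 / 2 ^ w.depth) ≤ ∫⁻ q, maxRegret f
          (w.extend hA hcell g a₁ a₂ c v) (fun _ => a₁) w.lo w.hi q ∂(L.prod f.seedLaw) := by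
  classical
  by_contra! hcon
  have hlo0 : (0 : ℝ) < w.lo := by exact_mod_cast hlo1
  have hpow1 : (1 : ℝ) ≤ 2 ^ w.depth := one_le_pow₀ (by norm_num)
  set η : ℝ := w.level ^ 2 / 128 / 2 ^ w.depth with hη
  have hη0 : 0 ≤ η := by positivity
  have hη1 : η ≤ w.level ^ 2 / 128 := div_le_self (by positivity) hpow1
  have hη2 : η ≤ w.level / 4 := by nlinarith
  have hη3 : η ≤ 1 := by linarith
  have hstartlo : w.start ≤ w.lo := by
    have : (w.start : ℝ) ≤ w.lo := hstart.trans (mul_le_of_le_one_left hlo0.le hη3)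
    exact_mod_cast this
  have hstart4 : 4 * (w.start : ℝ) ≤ w.level * w.lo := by
    have : η * w.lo ≤ w.level / 4 * w.lo := by gcongr
    linarith
  have hσ : ENNReal.ofReal (w.start / w.lo) ≤ ENNReal.ofReal η :=
    ENNReal.ofReal_le_ofReal ((div_le_iff₀ hlo0).2 hstart)
  set B : Set (ℕ → 𝓧) := {x | ∃ T, w.IsStop x T} with hB
  have hBm : MeasurableSet B := by
    rw [hB, Set.ofPred_exists]
    exact MeasurableSet.iUnion fun T => w.measurableSet_isStop hA hcell T
  set κ : ℝ≥0∞ := (Fintype.card (K → Bool) : ℝ≥0∞) * ENNReal.ofReal (w.level / 16) with hκ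
  have hlow : ∀ q : (ℕ → 𝓧) × f.Seed, (Prod.fst ⁻¹' B).indicator (fun _ => κ) q ≤
      ∑ c : K → Bool, ((ENNReal.ofReal (w.start / w.lo) +
          maxRegret f (w.extend hA hcell g a₁ a₂ c w.depth) (π c) w.lo w.hi q) +
        ∑ v ∈ Finset.range w.depth, (2 : ℝ≥0∞) ^ (w.depth - 1 - v) *
          (ENNReal.ofReal (w.start / w.lo) +
            maxRegret f (w.extend hA hcell g a₁ a₂ c v) (fun _ => a₁) w.lo w.hi q)) := by
    intro q
    by_cases hq : q ∈ Prod.fst ⁻¹' B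
    · rw [Set.indicator_of_mem hq]
      obtain ⟨T, hT⟩ := hq
      exact w.sum_maxRegret_ge hA hcell g f hT ha hπ hstartlo hlo1
        (RewardWindow.card_times hT hdepth hJ hstart4 hlo1)
    · rw [Set.indicator_of_notMem hq]
      exact zero_le
  have hint := lintegral_mono (μ := L.prod f.seedLaw) hlow
  have hm1 : ∀ c, Measurable (maxRegret f (w.extend hA hcell g a₁ a₂ c w.depth) (π c) w.lo w.hi) :=
    fun c => measurable_maxRegret f _ (hπm c) _ _
  have hm2 : ∀ c v, Measurable
      (maxRegret f (w.extend hA hcell g a₁ a₂ c v) (fun _ => a₁) w.lo w.hi) :=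
    fun c v => measurable_maxRegret f _ measurable_const _ _
  have hm3 : ∀ c, Measurable fun q => ∑ v ∈ Finset.range w.depth, (2 : ℝ≥0∞) ^ (w.depth - 1 - v) *
          (ENNReal.ofReal (w.start / w.lo) +
            maxRegret f (w.extend hA hcell g a₁ a₂ c v) (fun _ => a₁) w.lo w.hi q) := fun c =>
    Finset.measurable_sum _ fun v _ => ((hm2 c v).const_add _).const_mul _
  have hm4 : ∀ c, Measurable fun q => (ENNReal.ofReal (w.start / w.lo) +
          maxRegret f (w.extend hA hcell g a₁ a₂ c w.depth) (π c) w.lo w.hi q) +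
        ∑ v ∈ Finset.range w.depth, (2 : ℝ≥0∞) ^ (w.depth - 1 - v) *
          (ENNReal.ofReal (w.start / w.lo) +
            maxRegret f (w.extend hA hcell g a₁ a₂ c v) (fun _ => a₁) w.lo w.hi q) := fun c =>
    ((hm1 c).const_add _).add (hm3 c)
  rw [lintegral_indicator (measurable_fst hBm), setLIntegral_const,
    lintegral_finsetSum _ fun c _ => hm4 c] at hint
  have hPB : (L.prod f.seedLaw) (Prod.fst ⁻¹' B) = L B := by
    rw [← Measure.map_apply measurable_fst hBm, Measure.map_fst_prod]
    simp
  have hup : ∀ c : K → Bool, ∫⁻ q, ((ENNReal.ofReal (w.start / w.lo) +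
          maxRegret f (w.extend hA hcell g a₁ a₂ c w.depth) (π c) w.lo w.hi q) +
        ∑ v ∈ Finset.range w.depth, (2 : ℝ≥0∞) ^ (w.depth - 1 - v) *
          (ENNReal.ofReal (w.start / w.lo) +
            maxRegret f (w.extend hA hcell g a₁ a₂ c v) (fun _ => a₁) w.lo w.hi q))
        ∂(L.prod f.seedLaw) ≤ ENNReal.ofReal (w.level ^ 2 / 32) := by
    intro c
    rw [lintegral_add_right _ (hm3 c), lintegral_add_right _ (hm1 c), lintegral_const,
      measure_univ, mul_one, lintegral_finsetSum _ fun v _ => ((hm2 c v).const_add _).const_mul _]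
    have h1 : ∀ v, ∫⁻ q, (2 : ℝ≥0∞) ^ (w.depth - 1 - v) *
          (ENNReal.ofReal (w.start / w.lo) +
            maxRegret f (w.extend hA hcell g a₁ a₂ c v) (fun _ => a₁) w.lo w.hi q)
          ∂(L.prod f.seedLaw) ≤ (2 : ℝ≥0∞) ^ (w.depth - 1 - v) * ENNReal.ofReal (2 * η) := by
      intro v
      rw [lintegral_const_mul _ ((hm2 c v).const_add _), lintegral_add_right _ (hm2 c v),
        lintegral_const, measure_univ, mul_one, two_mul, ENNReal.ofReal_add hη0 hη0]
      gcongr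
      exact ((hcon c).2 v).le
    have h2 : ∑ v ∈ Finset.range w.depth, (2 : ℝ≥0∞) ^ (w.depth - 1 - v) * ENNReal.ofReal (2 * η) ≤
        ENNReal.ofReal (w.level ^ 2 / 64) := by
      rw [← Finset.sum_mul]
      calc _ ≤ 2 ^ w.depth * ENNReal.ofReal (2 * η) := by
            gcongr
            exact sum_two_pow_le _
        _ = ENNReal.ofReal (w.level ^ 2 / 64) := by
          rw [show (2 : ℝ≥0∞) ^ w.depth = ENNReal.ofReal (2 ^ w.depth) by
            rw [ENNReal.ofReal_pow (by norm_num), ENNReal.ofReal_ofNat],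
            ← ENNReal.ofReal_mul (by positivity), hη]
          congr 1
          field_simp
          norm_num
    calc _ ≤ (ENNReal.ofReal (w.level ^ 2 / 128) + ENNReal.ofReal (w.level ^ 2 / 128)) +
          ENNReal.ofReal (w.level ^ 2 / 64) := by
          refine add_le_add (add_le_add ?_ (hcon c).1.le)
            ((Finset.sum_le_sum fun v _ => h1 v).trans h2)
          exact hσ.trans (ENNReal.ofReal_le_ofReal hη1)
      _ = _ := by
        rw [← ENNReal.ofReal_add (by positivity) (by positivity),
          ← ENNReal.ofReal_add (by positivity) (by positivity)]
        congr 1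
        ring
  have hup' := hint.trans (Finset.sum_le_sum fun c _ => hup c)
  rw [Finset.sum_const, nsmul_eq_mul, Finset.card_univ, hPB] at hup'
  have hfin : κ * ENNReal.ofReal w.level ≤
      (Fintype.card (K → Bool) : ℝ≥0∞) * ENNReal.ofReal (w.level ^ 2 / 32) :=
    (by gcongr : κ * ENNReal.ofReal w.level ≤ κ * L B).trans hup'
  rw [hκ, mul_assoc, ENNReal.mul_le_mul_iff_right (by simp) (by simp),
    ← ENNReal.ofReal_mul (by positivity), ENNReal.ofReal_le_ofReal_iff (by positivity)] at hfin
  nlinarith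

end Dichotomy

end Forcing

/-! ### The game against the learner -/

section Game

variable {𝓧 : Type u} {𝓐 : Type v} [MeasurableSpace 𝓧]

/-- Finitely many contexts are separated by a fine finite partition, up to small probability. -/
theorem exists_separating_cells [MeasurableEq 𝓧] [MeasurableSpace.CountablySeparated 𝓧]
    (L : Measure (ℕ → 𝓧)) [IsProbabilityMeasure L] (N : ℕ) {δ : ℝ≥0∞} (hδ : 0 < δ) :
    ∃ (m : ℕ) (cell : 𝓧 → (Fin m → Bool)), Measurable cell ∧
      L {x | ∀ i < N, ∀ j < N, cell (x i) = cell (x j) → x i = x j}ᶜ < δ := by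
  obtain ⟨φ, hφm, hφi⟩ := MeasurableSpace.measurable_injection_nat_bool_of_countablySeparated 𝓧
  let cell : (m : ℕ) → 𝓧 → (Fin m → Bool) := fun m y i => φ y i
  have hcm : ∀ m, Measurable (cell m) := fun m =>
    measurable_pi_lambda _ fun i => (measurable_pi_apply _).comp hφm
  let S : ℕ → Set (ℕ → 𝓧) := fun m =>
    {x | ∀ i < N, ∀ j < N, cell m (x i) = cell m (x j) → x i = x j}
  have hSm : ∀ m, MeasurableSet (S m) := by
    intro m
    have h : S m = ⋂ i, ⋂ (_ : i < N), ⋂ j, ⋂ (_ : j < N),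
          ({x : ℕ → 𝓧 | cell m (x i) = cell m (x j)}ᶜ ∪ {x : ℕ → 𝓧 | x i = x j}) := by
      ext x
      simp [S, imp_iff_not_or]
    rw [h]
    refine MeasurableSet.iInter fun i => MeasurableSet.iInter fun _ => MeasurableSet.iInter fun j =>
      MeasurableSet.iInter fun _ => MeasurableSet.union ?_ ?_
    · exact (measurableSet_eq_fun ((hcm m).comp (measurable_pi_apply i))
        ((hcm m).comp (measurable_pi_apply j))).compl
    · exact measurableSet_eq_fun (measurable_pi_apply i) (measurable_pi_apply j)
  have hmono : Monotone S := by
    intro m m' hmm x hx i hi j hj hc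
    refine hx i hi j hj (funext fun l => ?_)
    exact congrFun hc ⟨l, l.isLt.trans_le hmm⟩
  have hempty : ⋂ m, (S m)ᶜ = ∅ := by
    rw [← Set.compl_iUnion, Set.compl_empty_iff, Set.eq_univ_iff_forall]
    intro x
    have h1 : ∀ i j, ∀ᶠ m in atTop, cell m (x i) = cell m (x j) → x i = x j := by
      intro i j
      by_cases hij : x i = x j
      · exact Eventually.of_forall fun _ _ => hij
      · obtain ⟨l, hl⟩ := Function.ne_iff.1 (hφi.ne hij)
        filter_upwards [eventually_gt_atTop l] with m hm hc
        exact absurd (congrFun hc ⟨l, hm⟩) hl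
    have h2 : ∀ᶠ m in atTop, ∀ i ∈ Set.Iio N, ∀ j ∈ Set.Iio N,
        cell m (x i) = cell m (x j) → x i = x j := by
      rw [eventually_all_finite (Set.finite_Iio N)]
      intro i _
      rw [eventually_all_finite (Set.finite_Iio N)]
      exact fun j _ => h1 i j
    obtain ⟨m, hm⟩ := h2.exists
    exact Set.mem_iUnion.2 ⟨m, fun i hi j hj => hm i hi j hj⟩
  have hlim := tendsto_measure_iInter_atTop (μ := L) (s := fun m => (S m)ᶜ)
    (fun m => (hSm m).compl.nullMeasurableSet)
    (fun m m' h => Set.compl_subset_compl.2 (hmono h)) ⟨0, measure_ne_top _ _⟩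
  rw [hempty, measure_empty] at hlim
  obtain ⟨m, hm⟩ := (hlim.eventually_lt_const hδ).exists
  exact ⟨m, cell m, hcm m, hm⟩

theorem exists_finite_horizon [MeasurableEq 𝓧] (L : Measure (ℕ → 𝓧)) (p T₀ : ℕ) {A : Set 𝓧}
    (hA : MeasurableSet A) {c : ℝ≥0∞}
    (h : c < ∫⁻ x, (⨆ T' : ℕ, ⨆ _ : T₀ ≤ T', empFreq p A x T') ∂L) :
    ∃ T₁, T₀ ≤ T₁ ∧ c < ∫⁻ x, (⨆ T ∈ Set.Icc T₀ T₁, empFreq p A x T) ∂L := by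
  have h1 : ∀ x : ℕ → 𝓧, (⨆ T' : ℕ, ⨆ _ : T₀ ≤ T', empFreq p A x T') =
      ⨆ k : ℕ, ⨆ T ∈ Set.Icc T₀ (T₀ + k), empFreq p A x T := by
    intro x
    refine le_antisymm (iSup₂_le fun T hT => ?_) (iSup_le fun k => iSup₂_le fun T hT => ?_)
    · refine le_trans ?_ (le_iSup _ T)
      exact le_iSup₂ (f := fun T' (_ : T' ∈ Set.Icc T₀ (T₀ + T)) => empFreq p A x T') T
        ⟨hT, Nat.le_add_left _ _⟩
    · exact le_iSup₂ (f := fun T' (_ : T₀ ≤ T') => empFreq p A x T') T hT.1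
  simp only [h1] at h
  rw [lintegral_iSup] at h
  · obtain ⟨k, hk⟩ := lt_iSup_iff.1 h
    exact ⟨T₀ + k, Nat.le_add_right _ _, hk⟩
  · exact fun k => Measurable.iSup fun T => Measurable.iSup fun _ => measurable_empFreq p hA T
  · intro k k' hk x
    refine biSup_mono fun T hT => ⟨hT.1, hT.2.trans (by gcongr)⟩

/-- A large expected maximal frequency makes a window open with positive probability. -/
theorem exists_cells_isStop [MeasurableEq 𝓧] [MeasurableSpace.CountablySeparated 𝓧]
    (L : Measure (ℕ → 𝓧)) [IsProbabilityMeasure L] (p V H T₀ : ℕ) {A : Set 𝓧}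
    (hA : MeasurableSet A) {ε : ℝ} (hε : 0 < ε)
    (h : ENNReal.ofReal ε < ∫⁻ x, (⨆ T' : ℕ, ⨆ _ : T₀ ≤ T', empFreq p A x T') ∂L) :
    ∃ (T₁ m : ℕ) (cell : 𝓧 → (Fin m → Bool)), T₀ ≤ T₁ ∧ Measurable cell ∧
      ENNReal.ofReal (ε / 4) ≤
        L {x | ∃ T, (RewardWindow.mk p V H T₀ T₁ (ε / 4) A cell).IsStop x T} := by
  obtain ⟨T₁, hT₁, h1⟩ := exists_finite_horizon L p T₀ hA h
  have hε4 : (0 : ℝ) < ε / 4 := by positivity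
  obtain ⟨m, cell, hcell, hsep⟩ := exists_separating_cells L T₁ (ENNReal.ofReal_pos.2 hε4)
  refine ⟨T₁, m, cell, hT₁, hcell, ?_⟩
  set B := {x | ∃ T, (RewardWindow.mk p V H T₀ T₁ (ε / 4) A cell).IsStop x T} with hB
  set S := {x : ℕ → 𝓧 | ∀ i < T₁, ∀ j < T₁, cell (x i) = cell (x j) → x i = x j} with hS
  set θ := ENNReal.ofReal (ε / 4) with hθ
  have hBm : MeasurableSet B := by
    rw [hB, Set.ofPred_exists]
    exact MeasurableSet.iUnion fun T => RewardWindow.measurableSet_isStop _ hA hcell T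
  have hle : ∀ x, (⨆ T ∈ Set.Icc T₀ T₁, empFreq p A x T) ≤
      (B ∪ Sᶜ).indicator (fun _ => (1 : ℝ≥0∞)) x + θ := by
    intro x
    by_cases hx : x ∈ B ∪ Sᶜ
    · rw [Set.indicator_of_mem hx]
      exact (iSup₂_le fun T _ => empFreq_le_one p A x T).trans le_self_add
    · rw [Set.indicator_of_notMem hx, zero_add]
      refine iSup₂_le fun T hT => ?_
      by_contra hcon
      refine hx (Or.inl ?_)
      have hxS : x ∈ S := by
        by_contra hxS
        exact hx (Or.inr hxS)
      exact RewardWindow.exists_isStop (w := RewardWindow.mk p V H T₀ T₁ (ε / 4) A cell)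
        (fun i hi j hj => hxS i hi j hj) ⟨T, hT, (not_le.1 hcon).le⟩
  have h2 : ENNReal.ofReal ε ≤ L B + θ + θ := by
    calc ENNReal.ofReal ε ≤ ∫⁻ x, (⨆ T ∈ Set.Icc T₀ T₁, empFreq p A x T) ∂L := h1.le
      _ ≤ ∫⁻ x, ((B ∪ Sᶜ).indicator (fun _ => (1 : ℝ≥0∞)) x + θ) ∂L := lintegral_mono hle
      _ = ∫⁻ x, (B ∪ Sᶜ).indicator (fun _ => (1 : ℝ≥0∞)) x ∂L + θ := by
        rw [lintegral_add_right _ measurable_const]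
        simp
      _ ≤ L (B ∪ Sᶜ) + θ := by
        gcongr
        exact lintegral_indicator_one_le _
      _ ≤ L B + θ + θ := by
        gcongr
        exact (measure_union_le _ _).trans (by gcongr)
  by_contra hcon
  have h3 : L B + θ + θ < θ + θ + θ := by
    have := not_le.1 hcon
    exact ENNReal.add_lt_add_right (by simp [hθ]) (ENNReal.add_lt_add_right (by simp [hθ]) this)
  have h4 := h2.trans_lt h3
  rw [hθ, ← ENNReal.ofReal_add hε4.le hε4.le, ← ENNReal.ofReal_add (by positivity) hε4.le,
    ENNReal.ofReal_lt_ofReal_iff (by positivity)] at h4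
  linarith

variable [MeasurableSpace 𝓐] [Countable 𝓐] [MeasurableSingletonClass 𝓐] [MeasurableEq 𝓧]
  [MeasurableSpace.CountablySeparated 𝓧] {L : Measure (ℕ → 𝓧)} [IsProbabilityMeasure L]
  {f : LearningRule.{u, v, w} 𝓧 𝓐} {a₁ a₂ : 𝓐}

open Classical in
/-- Any rewards before the time `H` can be continued so that the rule has large expected regret,
either against the constant policy `a₁`, or against all policies that play `a₂` on a suitable part
`C` of `A` and `a₁` on the rest of `A`.  The first bound depends on the scale, the second not. -/
theorem exists_regret_extension (f : LearningRule.{u, v, w} 𝓧 𝓐) (ha : a₁ ≠ a₂) (p : ℕ) {ε : ℝ}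
    (hε : 0 < ε) :
    ∃ η : ℝ≥0∞, 0 < η ∧ ∀ (g : DetRewards 𝓧 𝓐) (H : ℕ), ∃ N, ∀ T₀ ≥ N, ∀ A : Set 𝓧,
      MeasurableSet A →
      ENNReal.ofReal ε < ∫⁻ x, (⨆ T' : ℕ, ⨆ _ : T₀ ≤ T', empFreq p A x T') ∂L →
      ∃ (g' : DetRewards 𝓧 𝓐) (H' : ℕ), T₀ ≤ H' ∧ (∀ n < H, g'.reward n = g.reward n) ∧
        ((η ≤ ∫⁻ q, maxRegret f g' (fun _ => a₁) T₀ H' q ∂(L.prod f.seedLaw)) ∨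
        ∃ C ⊆ A, MeasurableSet C ∧ ∀ π : 𝓧 → 𝓐, Measurable π →
          (∀ y ∈ A, π y = if y ∈ C then a₂ else a₁) →
          ENNReal.ofReal ((ε / 4) ^ 2 / 128) ≤
            ∫⁻ q, maxRegret f g' π T₀ H' q ∂(L.prod f.seedLaw)) := by
  -- Periods that end before `T / 2 ^ J` contain at most a quarter of the required frequency, and at
  -- scale `p` there are about `J * 2 ^ p` later periods.
  obtain ⟨J, hJ⟩ := pow_unbounded_of_one_lt (8 / (ε / 4)) (one_lt_two : (1 : ℝ) < 2)
  have hε4 : (0 : ℝ) < ε / 4 := by positivity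
  have hJ' : 8 ≤ 2 ^ J * (ε / 4) := ((div_lt_iff₀ hε4).1 hJ).le
  set V := J * 2 ^ p with hV
  set η : ℝ := (ε / 4) ^ 2 / 128 / 2 ^ V with hη
  have hη0 : 0 < η := by positivity
  refine ⟨ENNReal.ofReal η, ENNReal.ofReal_pos.2 hη0, fun g H => ?_⟩
  refine ⟨max 1 ⌈H / η⌉₊, fun T₀ hT₀ A hA h => ?_⟩
  have hT1 : 1 ≤ T₀ := (le_max_left _ _).trans hT₀
  have hHT : (H : ℝ) ≤ η * T₀ := by
    have h1 : (H : ℝ) / η ≤ T₀ :=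
      (Nat.le_ceil _).trans (by exact_mod_cast (le_max_right _ _).trans hT₀)
    rw [div_le_iff₀ hη0] at h1
    linarith
  have hε1 : ε < 1 := by
    have h1 : ∫⁻ x, (⨆ T' : ℕ, ⨆ _ : T₀ ≤ T', empFreq p A x T') ∂L ≤ 1 := by
      calc _ ≤ ∫⁻ _, 1 ∂L :=
            lintegral_mono fun x => iSup₂_le fun T _ => empFreq_le_one p A x T
        _ = 1 := by simp
    exact ENNReal.ofReal_lt_one.1 (h.trans_le h1)
  obtain ⟨T₁, m, cell, hT₁, hcell, hB⟩ := exists_cells_isStop L p V H T₀ hA hε h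
  set w := RewardWindow.mk p V H T₀ T₁ (ε / 4) A cell with hw
  by_contra hcon
  -- If the second alternative fails, then every colouring has a fitted policy with small regret.
  have hno : ∀ c : (Fin m → Bool) → Bool, ∃ π : 𝓧 → 𝓐, Measurable π ∧
      (∀ y ∈ A, π y = if c (cell y) = true then a₂ else a₁) ∧
      ¬ ENNReal.ofReal ((ε / 4) ^ 2 / 128) ≤ ∫⁻ q, maxRegret f
        (w.extend hA hcell g a₁ a₂ c V) π T₀ T₁ q ∂(L.prod f.seedLaw) := by
    intro c
    by_contra hc
    push Not at hc
    refine hcon ⟨w.extend hA hcell g a₁ a₂ c V, T₁, hT₁,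
      fun n hn => w.extend_of_lt_start hA hcell g a₁ a₂ c V hn, Or.inr
        ⟨A ∩ {y | c (cell y) = true}, Set.inter_subset_left, hA.inter
          (hcell (MeasurableSet.of_discrete (s := {k | c k = true}))), fun π hπ hπA => ?_⟩⟩
    refine hc π hπ fun y hy => ?_
    rw [hπA y hy]
    simp [hy]
  choose π hπm hπA hπno using hno
  obtain ⟨c, h1 | ⟨v, h1⟩⟩ := w.exists_regret_ge hA hcell g f ha (L := L) hπm hπA (J := J) hV hJ'
    hε4 (by simp only [hw]; linarith) hT1 hHT hB
  · exact hπno c h1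
  · exact hcon ⟨w.extend hA hcell g a₁ a₂ c v, T₁, hT₁,
      fun n hn => w.extend_of_lt_start hA hcell g a₁ a₂ c v hn, Or.inl h1⟩

open Classical in
/-- Regret against the constant policy `a₁` cannot be forced forever at a fixed scale, so that at
some time regret against a policy that is fitted to a set `A` is forced instead. -/
theorem exists_fitted_regret_extension (hf : ∀ P : PrescientRewards 𝓧 𝓐, f.IsConsistent L P)
    (ha : a₁ ≠ a₂) {ε : ℝ} (hε : 0 < ε) {Q : Set 𝓧 → Prop} (p : ℕ)
    (hstep : ∀ T₀ : ℕ, ∃ A, MeasurableSet A ∧ Q A ∧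
      ENNReal.ofReal ε < ∫⁻ x, (⨆ T' : ℕ, ⨆ _ : T₀ ≤ T', empFreq p A x T') ∂L)
    (g : DetRewards 𝓧 𝓐) (H : ℕ) :
    ∃ (g' : DetRewards 𝓧 𝓐) (T₀ H' : ℕ) (A C : Set 𝓧), H ≤ T₀ ∧ H < H' ∧
      (∀ n < H, g'.reward n = g.reward n) ∧ Q A ∧ C ⊆ A ∧ MeasurableSet C ∧
      ∀ π : 𝓧 → 𝓐, Measurable π → (∀ y ∈ A, π y = if y ∈ C then a₂ else a₁) →
        ENNReal.ofReal ((ε / 4) ^ 2 / 128) ≤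
          ∫⁻ q, maxRegret f g' π T₀ H' q ∂(L.prod f.seedLaw) := by
  by_contra hcon
  obtain ⟨η, hη, hext⟩ := exists_regret_extension (L := L) f ha p hε
  have hnext : ∀ s : {s : DetRewards 𝓧 𝓐 × ℕ // H ≤ s.2 ∧ ∀ n < H, s.1.reward n = g.reward n},
      ∃ (s' : {s : DetRewards 𝓧 𝓐 × ℕ // H ≤ s.2 ∧ ∀ n < H, s.1.reward n = g.reward n}) (T₀ : ℕ),
        s.1.2 < s'.1.2 ∧ s.1.2 ≤ T₀ ∧ (∀ n < s.1.2, s'.1.1.reward n = s.1.1.reward n) ∧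
        η ≤ ∫⁻ q, maxRegret f s'.1.1 (fun _ => a₁) T₀ s'.1.2 q ∂(L.prod f.seedLaw) := by
    rintro ⟨⟨g₁, H₁⟩, hH₁, hg₁⟩
    simp only at hH₁ hg₁
    obtain ⟨N, hN⟩ := hext g₁ H₁
    obtain ⟨A, hA, hQ, hfreq⟩ := hstep (max N (H₁ + 1))
    obtain ⟨g', H', hH', hg', hreg⟩ := hN _ (le_max_left _ _) A hA hfreq
    have h1 : H₁ + 1 ≤ H' := (le_max_right _ _).trans hH'
    have h2 : H₁ + 1 ≤ max N (H₁ + 1) := le_max_right _ _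
    have h3 : ∀ n < H, g'.reward n = g.reward n := fun n hn => by
      rw [hg' n (hn.trans_le hH₁), hg₁ n hn]
    rcases hreg with hreg | ⟨C, hCA, hC, hreg⟩
    · exact ⟨⟨⟨g', H'⟩, by simp only; omega, h3⟩, max N (H₁ + 1), h1, by simp only; omega, hg', hreg⟩
    · exact absurd ⟨g', max N (H₁ + 1), H', A, C, by omega, by omega, h3, hQ, hCA, hC, hreg⟩ hcon
  choose F T₀ h1 h2 h3 h4 using hnext
  -- Otherwise regret against `a₁` is forced by every continuation, again and again.
  let s : ℕ → {s : DetRewards 𝓧 𝓐 × ℕ // H ≤ s.2 ∧ ∀ n < H, s.1.reward n = g.reward n} :=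
    fun k => Nat.rec ⟨⟨g, H⟩, le_rfl, fun _ _ => rfl⟩ (fun _ s => F s) k
  exact no_extension_chain hf (measurable_const (a := a₁)) hη (fun k => (s k).1.1)
    (fun k => (s k).1.2) (fun k => T₀ (s k)) (fun k => h1 (s k)) (fun k => h2 (s k))
    (fun k => h3 (s k)) (fun k => h4 (s k))

/-- The game: if at every stage a set `A`, disjoint from the set `D` of the contexts used so far,
can be found at a scale that is fixed for the stage, with expected maximal frequency above `ε` at
arbitrarily late times, then no rule is consistent with all prescient rewards. -/
theorem not_consistent_of_game (hf : ∀ P : PrescientRewards 𝓧 𝓐, f.IsConsistent L P)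
    (ha : a₁ ≠ a₂) {ε : ℝ} (hε : 0 < ε) {Inv : Set 𝓧 → Prop} (h0 : Inv ∅)
    (hstep : ∀ D, Inv D → ∃ p, ∀ T₀ : ℕ, ∃ A, MeasurableSet A ∧ (Disjoint A D ∧ Inv (D ∪ A)) ∧
      ENNReal.ofReal ε < ∫⁻ x, (⨆ T' : ℕ, ⨆ _ : T₀ ≤ T', empFreq p A x T') ∂L) : False := by
  classical
  have hnext : ∀ s : DetRewards 𝓧 𝓐 × ℕ × {D : Set 𝓧 // Inv D},
      ∃ (g' : DetRewards 𝓧 𝓐) (T₀ H' : ℕ) (A C : Set 𝓧), s.2.1 ≤ T₀ ∧ s.2.1 < H' ∧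
      (∀ n < s.2.1, g'.reward n = s.1.reward n) ∧ (Disjoint A s.2.2.1 ∧ Inv (s.2.2.1 ∪ A)) ∧
      C ⊆ A ∧ MeasurableSet C ∧
      ∀ π : 𝓧 → 𝓐, Measurable π → (∀ y ∈ A, π y = if y ∈ C then a₂ else a₁) →
        ENNReal.ofReal ((ε / 4) ^ 2 / 128) ≤
          ∫⁻ q, maxRegret f g' π T₀ H' q ∂(L.prod f.seedLaw) := by
    rintro ⟨g, H, D, hD⟩
    obtain ⟨p, hp⟩ := hstep D hD
    exact exists_fitted_regret_extension hf ha hε p hp g H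
  choose G T₀ H A C h1 h2 h3 h4 h5 h6 h7 using hnext
  let s : ℕ → DetRewards 𝓧 𝓐 × ℕ × {D : Set 𝓧 // Inv D} :=
    fun k => Nat.rec (⟨fun _ _ _ => 0, fun _ _ => measurable_const⟩, 0, ⟨∅, h0⟩)
      (fun _ s => (G s, H s, ⟨s.2.2.1 ∪ A s, (h4 s).2⟩)) k
  have hs : ∀ k, s (k + 1) = (G (s k), H (s k), ⟨(s k).2.2.1 ∪ A (s k), (h4 (s k)).2⟩) :=
    fun _ => rfl
  -- The sets of the stages are disjoint, so that their fitted policies combine to the policy `π`.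
  have hD : ∀ j k, j < k → A (s j) ⊆ (s k).2.2.1 := by
    intro j k hjk
    induction k, hjk using Nat.le_induction with
    | base => rw [hs]; exact Set.subset_union_right
    | succ k _ ih => rw [hs]; exact ih.trans Set.subset_union_left
  have hdisj : ∀ j k, j < k → Disjoint (A (s j)) (A (s k)) := fun j k hjk =>
    ((h4 (s k)).1.mono_right (hD j k hjk)).symm
  let π : 𝓧 → 𝓐 := fun y => if y ∈ ⋃ k, C (s k) then a₂ else a₁
  have hπ : Measurable π :=
    Measurable.ite (MeasurableSet.iUnion fun k => h6 (s k)) measurable_const measurable_const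
  have hπA : ∀ k, ∀ y ∈ A (s k), π y = if y ∈ C (s k) then a₂ else a₁ := by
    intro k y hy
    have h : y ∈ ⋃ j, C (s j) ↔ y ∈ C (s k) := by
      refine ⟨fun h => ?_, fun h => Set.mem_iUnion.2 ⟨k, h⟩⟩
      obtain ⟨j, hj⟩ := Set.mem_iUnion.1 h
      rcases lt_trichotomy j k with hjk | rfl | hjk
      · exact absurd hy (Set.disjoint_left.1 (hdisj j k hjk) (h5 _ hj))
      · exact hj
      · exact absurd (h5 _ hj) (Set.disjoint_left.1 (hdisj k j hjk) hy)
    simp only [π, h]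
  have hc : 0 < ENNReal.ofReal ((ε / 4) ^ 2 / 128) := ENNReal.ofReal_pos.2 (by positivity)
  exact no_extension_chain hf hπ hc (fun k => (s k).1) (fun k => (s k).2.1) (fun k => T₀ (s k))
    (fun k => h2 (s k)) (fun k => h1 (s k)) (fun k => h3 (s k))
    (fun k => h7 (s k) π hπ (hπA k))

end Game

/-! ### The conditions on the process -/

section Conditions

variable {𝓧 : Type u} {Ω : Type z} [MeasurableSpace Ω] [MeasurableSpace 𝓧]

theorem deltaBarAt_succ_le (μ : Measure Ω) (X : ℕ → Ω → 𝓧) (p : ℕ) (ε : ℝ) (T : ℕ) :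
    deltaBarAt μ X (p + 1) ε T ≤ deltaBarAt μ X p ε T := by
  refine sSup_le_sSup ?_
  rintro δ ⟨h1, h⟩
  refine ⟨h1, fun A hA hl => (lintegral_mono fun ω => ?_).trans (h A hA hl)⟩
  exact iSup₂_mono fun T' _ => empFreq_le_succ p A _ T'

theorem deltaBar_antitone (μ : Measure Ω) (X : ℕ → Ω → 𝓧) (ε : ℝ) :
    Antitone fun p => deltaBar μ X p ε := by
  refine antitone_nat_of_succ_le fun p => ?_
  rw [deltaBar_eq_iSup, deltaBar_eq_iSup]
  exact iSup_mono fun T => deltaBarAt_succ_le μ X p ε T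

variable [MeasurableEq 𝓧]

theorem measurable_iSup_empFreq (p T₀ : ℕ) {A : Set 𝓧} (hA : MeasurableSet A) :
    Measurable fun x : ℕ → 𝓧 => ⨆ T' : ℕ, ⨆ _ : T₀ ≤ T', empFreq p A x T' :=
  Measurable.iSup fun T => Measurable.iSup fun _ => measurable_empFreq p hA T

/-- The expected limit submeasure controls the expected frequencies at late times. -/
theorem exists_lintegral_iSup_empFreq_lt (L : Measure (ℕ → 𝓧)) [IsProbabilityMeasure L] (p : ℕ)
    {A : Set 𝓧} (hA : MeasurableSet A) {c : ℝ≥0∞} (h : ∫⁻ x, limitSubmeasure p A x ∂L < c) :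
    ∃ T₀, ∀ T ≥ T₀, ∫⁻ x, (⨆ T' : ℕ, ⨆ _ : T ≤ T', empFreq p A x T') ∂L < c := by
  have h1 : ∀ x : ℕ → 𝓧, limitSubmeasure p A x =
      ⨅ T, ⨆ T' : ℕ, ⨆ _ : T ≤ T', empFreq p A x T' := fun x => limsup_eq_iInf_iSup_of_nat
  have hanti : Antitone fun (T : ℕ) (x : ℕ → 𝓧) => ⨆ T' : ℕ, ⨆ _ : T ≤ T', empFreq p A x T' :=
    fun T S hTS x => biSup_mono fun T' h => hTS.trans h
  simp only [h1] at h
  rw [lintegral_iInf (fun T => measurable_iSup_empFreq p T hA) hanti] at h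
  · obtain ⟨T₀, hT₀⟩ := iInf_lt_iff.1 h
    exact ⟨T₀, fun T hT => (lintegral_mono (hanti hT)).trans_lt hT₀⟩
  · refine ne_top_of_le_ne_top ENNReal.one_ne_top ?_
    calc _ ≤ ∫⁻ _, 1 ∂L := lintegral_mono fun x => iSup₂_le fun T _ => empFreq_le_one p A x T
      _ = 1 := by simp

variable {𝓐 : Type v} [MeasurableSpace 𝓐] [Countable 𝓐] [MeasurableSingletonClass 𝓐]
  [MeasurableSpace.CountablySeparated 𝓧] {L : Measure (ℕ → 𝓧)} [IsProbabilityMeasure L]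
  {f : LearningRule.{u, v, w} 𝓧 𝓐} {a₁ a₂ : 𝓐}

/-- In the game, the sets of a sequence that violates `𝒞₄` are themselves disjoint. -/
theorem tendsto_lintegral_limitSubmeasure (hf : ∀ P : PrescientRewards 𝓧 𝓐, f.IsConsistent L P)
    (ha : a₁ ≠ a₂) {A : ℕ → Set 𝓧} (hA : ∀ i, MeasurableSet (A i))
    (hdisj : Pairwise fun i j => Disjoint (A i) (A j)) :
    Tendsto (fun i => ∫⁻ x, limitSubmeasure i (A i) x ∂L) atTop (𝓝 0) := by
  rw [ENNReal.tendsto_nhds_zero]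
  by_contra! hcon
  obtain ⟨ε, hε, hfreq⟩ := hcon
  obtain ⟨δ, hδ, hδε⟩ : ∃ δ : ℝ, 0 < δ ∧ ENNReal.ofReal δ ≤ ε := by
    refine ⟨(min ε 1).toReal, ENNReal.toReal_pos (by simpa using hε.ne') (by simp), ?_⟩
    rw [ENNReal.ofReal_toReal (by simp)]
    exact min_le_left _ _
  refine not_consistent_of_game hf ha hδ (Inv := fun D => ∃ n, ∀ j ≥ n, Disjoint (A j) D)
    ⟨0, fun _ _ => Set.disjoint_empty _⟩ ?_
  rintro D ⟨n, hn⟩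
  obtain ⟨i, hi, hiε⟩ := frequently_atTop.1 hfreq n
  refine ⟨i, fun T₀ => ⟨A i, hA i, ⟨hn i hi, i + 1, fun j hj => ?_⟩, ?_⟩⟩
  · exact Set.disjoint_union_right.2 ⟨hn j (by omega), hdisj (by omega)⟩
  · exact hδε.trans_lt (hiε.trans_le (lintegral_mono fun x => limitSubmeasure_le_iSup i (A i) x T₀))

/-- In the game, sets that violate the second part of `𝒞₇` are made disjoint by removing the
earlier ones, which have small limit submeasure and hence small frequency at late times. -/
theorem exists_limitSubmeasure_criterion (hf : ∀ P : PrescientRewards 𝓧 𝓐, f.IsConsistent L P)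
    (ha : a₁ ≠ a₂) {ε : ℝ} (hε : 0 < ε) :
    ∃ δ : ℝ≥0∞, 0 < δ ∧ δ ≤ 1 ∧ ∀ p, ∃ T : ℕ, ∀ A : Set 𝓧, MeasurableSet A →
      (⨆ l : ℕ, ∫⁻ x, limitSubmeasure l A x ∂L) ≤ δ →
      ∫⁻ x, (⨆ T' : ℕ, ⨆ _ : T ≤ T', empFreq p A x T') ∂L ≤ ENNReal.ofReal ε := by
  by_contra! hcon
  have hε2 : 0 < ε / 2 := by positivity
  refine not_consistent_of_game hf ha hε2
    (Inv := fun D => MeasurableSet D ∧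
      (⨆ l : ℕ, ∫⁻ x, limitSubmeasure l D x ∂L) < ENNReal.ofReal (ε / 2)) ⟨.empty, ?_⟩ ?_
  · have h : ∀ (l : ℕ) (x : ℕ → 𝓧), limitSubmeasure l ∅ x = 0 := fun l x => by
      simp [limitSubmeasure, empFreq_empty]
    simp [h, hε]
  rintro D ⟨hD, hDε⟩
  obtain ⟨δ, hδ, hDδ⟩ : ∃ δ > 0, (⨆ l : ℕ, ∫⁻ x, limitSubmeasure l D x ∂L) + δ <
      ENNReal.ofReal (ε / 2) := by
    obtain ⟨r, hr, hr'⟩ := ENNReal.lt_iff_exists_add_pos_lt.1 hDε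
    exact ⟨r, by exact_mod_cast hr, hr'⟩
  obtain ⟨p, hp⟩ := hcon (min δ 1) (lt_min hδ one_pos) (min_le_right _ _)
  -- From the time `S` on, `D` is rare at the scale `p`; this is possible because `p` does not depend
  -- on the time from which `A` has to be frequent.
  obtain ⟨S, hS⟩ := exists_lintegral_iSup_empFreq_lt L p hD
    ((le_iSup (fun l => ∫⁻ x, limitSubmeasure l D x ∂L) p).trans_lt hDε)
  refine ⟨p, fun T₀ => ?_⟩
  obtain ⟨A, hA, hAδ, hAε⟩ := hp (max S T₀)
  refine ⟨A \ D, hA.diff hD, ⟨Set.disjoint_sdiff_left, hD.union (hA.diff hD), ?_⟩, ?_⟩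
  · refine lt_of_le_of_lt (iSup_le fun l => ?_) hDδ
    calc ∫⁻ x, limitSubmeasure l (D ∪ A \ D) x ∂L
        ≤ ∫⁻ x, (limitSubmeasure l D x + limitSubmeasure l A x) ∂L := lintegral_mono fun x =>
          (limitSubmeasure_union_le l _ _ x).trans
            (add_le_add le_rfl (limitSubmeasure_mono l Set.sdiff_subset x))
      _ = ∫⁻ x, limitSubmeasure l D x ∂L + ∫⁻ x, limitSubmeasure l A x ∂L :=
        lintegral_add_left (measurable_limitSubmeasure l hD) _
      _ ≤ _ := add_le_add (le_iSup (fun l => ∫⁻ x, limitSubmeasure l D x ∂L) l)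
        ((le_iSup (fun l => ∫⁻ x, limitSubmeasure l A x ∂L) l).trans
          (hAδ.trans (min_le_left _ _)))
  · have h1 : ∫⁻ x, (⨆ T' : ℕ, ⨆ _ : max S T₀ ≤ T', empFreq p A x T') ∂L ≤
        ∫⁻ x, (⨆ T' : ℕ, ⨆ _ : T₀ ≤ T', empFreq p (A \ D) x T') ∂L +
        ∫⁻ x, (⨆ T' : ℕ, ⨆ _ : max S T₀ ≤ T', empFreq p D x T') ∂L := by
      rw [← lintegral_add_left (measurable_iSup_empFreq p T₀ (hA.diff hD))]
      refine lintegral_mono fun x => iSup₂_le fun T hT => ?_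
      have hsub : A ⊆ (A \ D) ∪ D := by
        rw [Set.sdiff_union_self]
        exact Set.subset_union_left
      refine ((empFreq_mono hsub x T).trans (empFreq_union_le p _ _ x T)).trans (add_le_add ?_ ?_)
      · exact le_iSup₂ (f := fun T' (_ : T₀ ≤ T') => empFreq p (A \ D) x T') T
          ((le_max_right _ _).trans hT)
      · exact le_iSup₂ (f := fun T' (_ : max S T₀ ≤ T') => empFreq p D x T') T hT
    have h2 := hS (max S T₀) (le_max_left _ _)
    by_contra hle
    have h3 : ENNReal.ofReal ε < ENNReal.ofReal (ε / 2) + ENNReal.ofReal (ε / 2) :=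
      (hAε.trans_le h1).trans (ENNReal.add_lt_add_of_le_of_lt
        (ne_top_of_le_ne_top ENNReal.ofReal_ne_top (not_lt.1 hle)) (not_lt.1 hle) h2)
    rw [← ENNReal.ofReal_add hε2.le hε2.le, add_halves] at h3
    exact lt_irrefl _ h3

end Conditions

end ContextualBandit

theorem mainTheorem6 {𝓧 : Type u} [TopologicalSpace 𝓧]
    [TopologicalSpace.MetrizableSpace 𝓧] [TopologicalSpace.SeparableSpace 𝓧]
    [MeasurableSpace 𝓧] [BorelSpace 𝓧]
    {𝓐 : Type v} [MeasurableSpace 𝓐] [DiscreteMeasurableSpace 𝓐] [Finite 𝓐]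
    (h𝓐 : 2 ≤ Nat.card 𝓐)
    {Ω : Type z} [MeasurableSpace Ω] (μ : MeasureTheory.Measure Ω)
    [MeasureTheory.IsProbabilityMeasure μ]
    (X : ℕ → Ω → 𝓧) (hX : ∀ n, Measurable (X n))
    (hlearn : ContextualBandit.AdmitsPrescientLearning.{u, v, w, z} 𝓐 μ X) :
    ContextualBandit.C7 μ X := by
  let _ := TopologicalSpace.metrizableSpaceMetric 𝓧
  have : SecondCountableTopology 𝓧 := UniformSpace.secondCountable_of_separable 𝓧
  have hXm : Measurable fun ω n => X n ω := measurable_pi_lambda _ hX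
  have : IsProbabilityMeasure (μ.map fun ω n => X n ω) :=
    Measure.isProbabilityMeasure_map hXm.aemeasurable
  have : Nontrivial 𝓐 := Finite.one_lt_card_iff_nontrivial.1 h𝓐
  obtain ⟨a₁, a₂, ha⟩ := exists_pair_ne 𝓐
  obtain ⟨f, hf⟩ := hlearn
  have hmap : ∀ {F : (ℕ → 𝓧) → ℝ≥0∞}, Measurable F →
      ∫⁻ ω, F (fun n => X n ω) ∂μ = ∫⁻ x, F x ∂(μ.map fun ω n => X n ω) :=
    fun hF => (lintegral_map hF hXm).symm
  refine ⟨fun A hA hdisj => ?_, fun ε hε => ?_⟩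
  · simp only [hmap (ContextualBandit.measurable_limitSubmeasure _ (hA _))]
    exact ContextualBandit.tendsto_lintegral_limitSubmeasure hf ha hA hdisj
  · refine ⟨⨅ p, ContextualBandit.deltaBar μ X p ε, ?_, tendsto_atTop_iInf (ContextualBandit.deltaBar_antitone μ X ε)⟩
    obtain ⟨δ, hδ, hδ1, hcrit⟩ := ContextualBandit.exists_limitSubmeasure_criterion hf ha hε
    refine hδ.trans_le (le_iInf fun p => ?_)
    obtain ⟨T, hT⟩ := hcrit p
    rw [ContextualBandit.deltaBar_eq_iSup]
    refine le_trans ?_ (le_iSup _ T)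
    refine le_sSup ⟨hδ1, fun A hA hl => ?_⟩
    rw [hmap (ContextualBandit.measurable_iSup_empFreq p T hA)]
    refine hT A hA ?_
    simpa only [hmap (ContextualBandit.measurable_limitSubmeasure _ hA)] using hl
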